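/- Let $k$ be an integer with $k\ge 2$ and let $R(t)=a_k t^k+\ldots+a_0$ be a polynomial with integer coefficients and $a_k>0$. For any positive integer $n$, let \[ r(n)=\#\{(p,j): p \text{ is a prime number},\ j \text{ is a positive integer},\ p+R(j)=n\}. \] Then there are constants $c_1>0$, $c_2>0$, $x_0>0$, depending only on $R$, such that \[ \#\Bigl\{n\in\mathbb{Z}: 1\le n\le x,\ r(n)\ge c_1\frac{x^{1/k}}{\ln x}\Bigr\}\ge c_2\,x \] for any real number $x\ge x_0$. -/

import Mathlib

/-- The number `r(n)` of pairs `(p, j)` with `p` a prime, `j` a positive integer and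
`p + R(j) = n`. For the polynomials considered (nonconstant, positive leading coefficient)
the set of such pairs is finite, so `Set.ncard` is its number of elements. -/
noncomputable def primePolyReprCount (R : Polynomial ℤ) (n : ℕ) : ℕ :=
  Set.ncard {q : ℕ × ℕ | q.1.Prime ∧ 1 ≤ q.2 ∧ (q.1 : ℤ) + R.eval (q.2 : ℤ) = (n : ℤ)}

/-! The proof is a second moment argument. Let `X = x^(1/k)`. Primes `p` up to about `x/2`, paired
with `j` up to a constant times `X`, give by Chebyshev at least a constant times `xX / log x` pairs,
and every `p + R(j)` lies in `[1, x]`. If the number of coincidences `p + R(j) = p' + R(j')` is `O(x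
X² / log² x)`, Cauchy–Schwarz forces a positive proportion of the integers up to `x` to have at
least half the guaranteed mean number of representations (`sq_card_le_mul_card_filter_mul_sum`).

For fixed `j, j'` a coincidence is a pair of primes with difference `h = R(j) - R(j')`. If `h ≠ 0`,
a Selberg-type sieve bounds their number by `O(N / log² N)` times `∏ (1 + 6/p)` over `p ∣ 2h`
(`card_prime_and_prime_add_le`). That product is bounded on average over `j'`, because a prime `p`
divides a polynomial value for only `O(J/p)` of the `j' < J` (`sum_prod_one_add_six_div_le`); the
bound is uniform in `j`. If `h = 0`, there are at most `k` choices of `j'` for each `j`, and the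
trivial bound suffices since `X ≥ log² x` eventually. -/

/-! ### Sums of periodic functions and the Chinese remainder theorem. -/

theorem sum_range_mul_of_periodic {m n : ℕ} (hm : 0 < m) (hn : 0 < n) (h : m.Coprime n)
    {f g : ℕ → ℝ} (hf : Function.Periodic f m) (hg : Function.Periodic g n) :
    ∑ i ∈ Finset.range (m * n), f i * g i
      = (∑ i ∈ Finset.range m, f i) * ∑ i ∈ Finset.range n, g i := by
  rw [Finset.sum_mul_sum, ← Finset.sum_product']
  refine Finset.sum_nbij' (fun x => (x % m, x % n))
    (fun q => (Nat.chineseRemainder h q.1 q.2 : ℕ)) ?_ ?_ ?_ ?_ ?_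
  · intro x _
    simp [Nat.mod_lt _ hm, Nat.mod_lt _ hn]
  · intro q _
    simpa using Nat.chineseRemainder_lt_mul h q.1 q.2 hm.ne' hn.ne'
  · intro x hx
    have hx := Finset.mem_range.1 hx
    have := Nat.chineseRemainder_modEq_unique h (a := x % m) (b := x % n) (z := x)
      (Nat.mod_modEq x m).symm (Nat.mod_modEq x n).symm
    have h2 := Nat.chineseRemainder_lt_mul h (x % m) (x % n) hm.ne' hn.ne'
    exact (Nat.ModEq.eq_of_lt_of_lt this hx h2).symm
  · rintro ⟨a, b⟩ hq
    simp only [Finset.mem_product, Finset.mem_range] at hq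
    have := (Nat.chineseRemainder h a b).2
    ext
    · exact Nat.mod_eq_of_modEq this.1 hq.1
    · exact Nat.mod_eq_of_modEq this.2 hq.2
  · intro x _
    simp [hf.map_mod_nat x, hg.map_mod_nat x]

theorem periodic_finset_prod {T : Finset ℕ} {f : ℕ → ℕ → ℝ}
    (hf : ∀ p ∈ T, Function.Periodic (f p) p) :
    Function.Periodic (fun n => ∏ p ∈ T, f p n) (∏ p ∈ T, p) := by
  intro n
  refine Finset.prod_congr rfl fun p hp => ?_
  obtain ⟨c, hc⟩ := Finset.dvd_prod_of_mem (fun p : ℕ => p) hp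
  rw [hc, mul_comm]
  simpa using (hf p hp).nat_mul c n

theorem sum_range_prod_of_periodic {T : Finset ℕ} (hT : ∀ p ∈ T, p.Prime) {f : ℕ → ℕ → ℝ}
    (hf : ∀ p ∈ T, Function.Periodic (f p) p) :
    ∑ n ∈ Finset.range (∏ p ∈ T, p), ∏ p ∈ T, f p n
      = ∏ p ∈ T, ∑ a ∈ Finset.range p, f p a := by
  induction T using Finset.induction_on with
  | empty => simp
  | insert q T hq ih =>
    have hT' : ∀ p ∈ T, p.Prime := fun p hp => hT p (Finset.mem_insert_of_mem hp)
    have hf' : ∀ p ∈ T, Function.Periodic (f p) p := fun p hp => hf p (Finset.mem_insert_of_mem hp)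
    have hqp := hT q (Finset.mem_insert_self _ _)
    simp only [Finset.prod_insert hq]
    rw [sum_range_mul_of_periodic hqp.pos (Finset.prod_pos fun p hp => (hT' p hp).pos) _
      (hf q (Finset.mem_insert_self _ _)) (periodic_finset_prod hf'), ih hT' hf']
    refine Nat.Coprime.prod_right fun p hp => ?_
    exact (Nat.coprime_primes hqp (hT' p hp)).2 fun h => hq (h ▸ hp)

theorem sum_range_mul_add_of_periodic {q : ℕ} {f : ℕ → ℝ} (hf : Function.Periodic f q)
    (c r : ℕ) :
    ∑ n ∈ Finset.range (q * c + r), f n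
      = c * ∑ n ∈ Finset.range q, f n + ∑ n ∈ Finset.range r, f n := by
  induction c with
  | zero => simp
  | succ c ih =>
    have : q * (c + 1) + r = q + (q * c + r) := by ring
    have h2 : ∀ n, f (q + n) = f n := fun n => by rw [add_comm]; exact hf n
    rw [this, Finset.sum_range_add]
    simp only [h2]
    rw [ih]
    push_cast; ring

theorem sum_range_le_of_periodic {q : ℕ} (hq : 0 < q) {f : ℕ → ℝ} (hf : Function.Periodic f q)
    {M : ℝ} (hM : ∀ n, f n ≤ M) (hM0 : 0 ≤ M) (N : ℕ) (hs : 0 ≤ ∑ n ∈ Finset.range q, f n) :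
    ∑ n ∈ Finset.range N, f n ≤ N / q * ∑ n ∈ Finset.range q, f n + q * M := by
  conv_lhs => rw [← Nat.div_add_mod N q]
  rw [sum_range_mul_add_of_periodic hf]
  refine add_le_add (mul_le_mul_of_nonneg_right Nat.cast_div_le hs) ?_
  calc ∑ n ∈ Finset.range (N % q), f n ≤ ∑ n ∈ Finset.range (N % q), M :=
        Finset.sum_le_sum fun n _ => hM n
    _ = (N % q : ℕ) * M := by simp
    _ ≤ q * M := by
        have : N % q ≤ q := (Nat.mod_lt _ hq).le
        gcongr

/-! ### The sieve inequality, by orthogonality of products of local weights. -/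

/-- The local factor of the Selberg weight for sieving `n (n + h)` by the prime `p`:
it has mean zero over a period. -/
noncomputable def pairWeight (h : ℤ) (p n : ℕ) : ℝ :=
  open Classical in
  if (p : ℤ) ∣ n ∨ (p : ℤ) ∣ n + h then -1 else 2 / ((p : ℝ) - 2)

theorem pairWeight_periodic (h : ℤ) (p : ℕ) : Function.Periodic (pairWeight h p) p := by
  intro n
  have h1 : ((n + p : ℕ) : ℤ) = n + p := by push_cast; ring
  unfold pairWeight
  simp only [h1, add_right_comm (n : ℤ) p h, dvd_add_self_right]

theorem abs_pairWeight_le {h : ℤ} {p : ℕ} (hp : 3 ≤ p) (n : ℕ) : |pairWeight h p n| ≤ p := by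
  have h3 : (3 : ℝ) ≤ p := by exact_mod_cast hp
  unfold pairWeight
  split_ifs
  · rw [abs_neg, abs_one]; linarith
  · have h0 : (0 : ℝ) < p - 2 := by linarith
    rw [abs_of_nonneg (by positivity), div_le_iff₀ h0]
    nlinarith

open Classical in
theorem card_filter_dvd_or_dvd_add {h : ℤ} {p : ℕ} (hp : p.Prime) (hh : ¬ (p : ℤ) ∣ h) :
    ((Finset.range p).filter fun n : ℕ => (p : ℤ) ∣ n ∨ (p : ℤ) ∣ n + h).card = 2 := by
  have hp0 : (0 : ℤ) < p := by exact_mod_cast hp.pos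
  have hnn := Int.emod_nonneg (-h) hp0.ne'
  have hlt := Int.emod_lt_of_pos (-h) hp0
  have hdm := Int.emod_add_mul_ediv (-h) p
  have key : ((Finset.range p).filter fun n : ℕ => (p : ℤ) ∣ n ∨ (p : ℤ) ∣ n + h)
      = {0, ((-h) % p).toNat} := by
    ext n
    simp only [Finset.mem_filter, Finset.mem_range, Finset.mem_insert, Finset.mem_singleton]
    constructor
    · rintro ⟨hn, h1 | h1⟩
      · left
        exact Nat.eq_zero_of_dvd_of_lt (by exact_mod_cast h1) hn
      · right
        have : (n : ℤ) = (-h) % p := by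
          have hm : (-h) % p = (n : ℤ) % p := Int.modEq_iff_dvd.2 (by simpa using h1)
          rw [hm, Int.emod_eq_of_lt (by positivity) (by exact_mod_cast hn)]
        omega
    · rintro (rfl | rfl)
      · exact ⟨hp.pos, by simp⟩
      · refine ⟨by omega, Or.inr ?_⟩
        rw [Int.toNat_of_nonneg hnn]
        exact ⟨-((-h) / p), by linarith⟩
  rw [key, Finset.card_pair]
  intro h0
  apply hh
  have : (-h) % p = 0 := by omega
  exact (dvd_neg).1 (Int.dvd_of_emod_eq_zero this)

theorem sum_pairWeight {h : ℤ} {p : ℕ} (hp : p.Prime) (hp3 : 3 ≤ p) (hh : ¬ (p : ℤ) ∣ h) :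
    ∑ n ∈ Finset.range p, pairWeight h p n = 0 := by
  classical
  have h3 : (3 : ℝ) ≤ p := by exact_mod_cast hp3
  have h0 : (p : ℝ) - 2 ≠ 0 := by linarith
  have hc := card_filter_dvd_or_dvd_add hp hh
  have hc' := Finset.card_filter_add_card_filter_not (s := Finset.range p)
    (fun n : ℕ => (p : ℤ) ∣ n ∨ (p : ℤ) ∣ n + h)
  rw [hc, Finset.card_range] at hc'
  have hc'' : (((Finset.range p).filter fun n : ℕ => ¬ ((p : ℤ) ∣ n ∨ (p : ℤ) ∣ n + h)).card : ℝ)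
      = p - 2 := by
    have : ((2 + ((Finset.range p).filter
        fun n : ℕ => ¬ ((p : ℤ) ∣ n ∨ (p : ℤ) ∣ n + h)).card : ℕ) : ℝ) = p := by rw [hc']
    push_cast at this
    linarith
  unfold pairWeight
  rw [Finset.sum_ite, Finset.sum_const, Finset.sum_const, hc, nsmul_eq_mul, nsmul_eq_mul, hc'']
  field_simp
  norm_num

theorem sum_pairWeight_sq {h : ℤ} {p : ℕ} (hp : p.Prime) (hp3 : 3 ≤ p) (hh : ¬ (p : ℤ) ∣ h) :
    ∑ n ∈ Finset.range p, pairWeight h p n * pairWeight h p n = p * (2 / ((p : ℝ) - 2)) := by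
  classical
  have h3 : (3 : ℝ) ≤ p := by exact_mod_cast hp3
  have h0 : (p : ℝ) - 2 ≠ 0 := by linarith
  have hs := sum_pairWeight hp hp3 hh
  have hc := card_filter_dvd_or_dvd_add hp hh
  -- The weight takes the two values `-1` and `g = 2/(p-2)`, so its square is `g` times itself plus
  -- `1 + g` on the two sifted classes; the linear part has sum zero.
  have e : ∀ n, pairWeight h p n * pairWeight h p n
      = (2 / ((p : ℝ) - 2)) * pairWeight h p n
        + (if (p : ℤ) ∣ n ∨ (p : ℤ) ∣ n + h then 1 + 2 / ((p : ℝ) - 2) else 0) := by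
    intro n
    unfold pairWeight
    split_ifs <;> ring
  simp only [e]
  rw [Finset.sum_add_distrib, ← Finset.mul_sum, hs, ← Finset.sum_filter, Finset.sum_const, hc]
  simp only [nsmul_eq_mul]
  field_simp
  ring

theorem abs_prod_pairWeight_le {h : ℤ} {T : Finset ℕ} (hT : ∀ p ∈ T, 3 ≤ p) (n : ℕ) :
    |∏ p ∈ T, pairWeight h p n| ≤ ((∏ p ∈ T, p : ℕ) : ℝ) := by
  rw [Finset.abs_prod, Nat.cast_prod]
  exact Finset.prod_le_prod (fun _ _ => abs_nonneg _) fun p hp => abs_pairWeight_le (hT p hp) n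

/-- Near-orthogonality: over a full period the sum factors over primes. The incomplete period costs
at most its length `z²` times the sup bound `z²`. -/
theorem sum_prod_pairWeight_mul_le {h : ℤ} {T T' : Finset ℕ}
    (hT : ∀ p ∈ T, p.Prime ∧ 3 ≤ p ∧ ¬ (p : ℤ) ∣ h)
    (hT' : ∀ p ∈ T', p.Prime ∧ 3 ≤ p ∧ ¬ (p : ℤ) ∣ h)
    {z : ℕ} (hz : ∏ p ∈ T, p ≤ z) (hz' : ∏ p ∈ T', p ≤ z) (N : ℕ) :
    ∑ n ∈ Finset.range N, (∏ p ∈ T, pairWeight h p n) * (∏ p ∈ T', pairWeight h p n)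
      ≤ (if T = T' then N * ∏ p ∈ T, (2 / ((p : ℝ) - 2)) else 0) + (z : ℝ) ^ 4 := by
  classical
  set U := T ∪ T' with hU
  have hUp : ∀ p ∈ U, p.Prime ∧ 3 ≤ p ∧ ¬ (p : ℤ) ∣ h := by
    intro p hp
    rcases Finset.mem_union.1 hp with hp | hp
    exacts [hT p hp, hT' p hp]
  set w : ℕ → ℕ → ℝ := fun p n =>
    (if p ∈ T then pairWeight h p n else 1) * (if p ∈ T' then pairWeight h p n else 1) with hw
  have hprod : ∀ n, (∏ p ∈ T, pairWeight h p n) * (∏ p ∈ T', pairWeight h p n)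
      = ∏ p ∈ U, w p n := by
    intro n
    rw [hw, Finset.prod_mul_distrib, Finset.prod_ite_mem, Finset.prod_ite_mem,
      Finset.inter_eq_right.2 Finset.subset_union_left,
      Finset.inter_eq_right.2 Finset.subset_union_right]
  have hper : ∀ p ∈ U, Function.Periodic (w p) p := by
    intro p _ n
    simp only [hw, pairWeight_periodic h p n]
  have hpos : 0 < ∏ p ∈ U, p := Finset.prod_pos fun p hp => (hUp p hp).1.pos
  have hle : ∏ p ∈ U, p ≤ z * z := by
    calc ∏ p ∈ U, p ≤ (∏ p ∈ T ∪ T', p) * ∏ p ∈ T ∩ T', p :=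
          Nat.le_mul_of_pos_right _ (Finset.prod_pos fun p hp =>
            (hT p (Finset.mem_inter.1 hp).1).1.pos)
      _ = (∏ p ∈ T, p) * ∏ p ∈ T', p := Finset.prod_union_inter
      _ ≤ z * z := Nat.mul_le_mul hz hz'
  have hsum : ∑ n ∈ Finset.range (∏ p ∈ U, p), ∏ p ∈ U, w p n
      = if T = T' then ((∏ p ∈ U, p : ℕ) : ℝ) * ∏ p ∈ T, (2 / ((p : ℝ) - 2)) else 0 := by
    rw [sum_range_prod_of_periodic (fun p hp => (hUp p hp).1) hper]
    split_ifs with hTT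
    · subst hTT
      have : U = T := by rw [hU, Finset.union_self]
      rw [this, Nat.cast_prod, ← Finset.prod_mul_distrib]
      refine Finset.prod_congr rfl fun p hp => ?_
      simp only [hw, if_pos hp]
      exact sum_pairWeight_sq (hT p hp).1 (hT p hp).2.1 (hT p hp).2.2
    -- A prime in exactly one of the two sets contributes a single mean-zero factor, which kills the
    -- product.
    · obtain ⟨p, hp⟩ : ∃ p, ¬ (p ∈ T ↔ p ∈ T') := by
        by_contra hcon
        push Not at hcon
        exact hTT (Finset.ext hcon)
      have hpU : p ∈ U := by
        rw [hU, Finset.mem_union]; tauto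
      refine Finset.prod_eq_zero hpU ?_
      rw [← sum_pairWeight (hUp p hpU).1 (hUp p hpU).2.1 (hUp p hpU).2.2]
      refine Finset.sum_congr rfl fun n _ => ?_
      by_cases h1 : p ∈ T <;> by_cases h2 : p ∈ T' <;> simp_all
  have hg : 0 ≤ ∏ p ∈ T, (2 / ((p : ℝ) - 2)) := by
    refine Finset.prod_nonneg fun p hp => ?_
    have : (3 : ℝ) ≤ p := by exact_mod_cast (hT p hp).2.1
    exact div_nonneg (by norm_num) (by linarith)
  have hbd : ∀ n, ∏ p ∈ U, w p n ≤ (z : ℝ) * z := by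
    intro n
    rw [← hprod]
    refine (le_abs_self _).trans ?_
    rw [abs_mul]
    gcongr
    · exact (abs_prod_pairWeight_le (fun p hp => (hT p hp).2.1) n).trans (by exact_mod_cast hz)
    · exact (abs_prod_pairWeight_le (fun p hp => (hT' p hp).2.1) n).trans (by exact_mod_cast hz')
  simp only [hprod]
  refine (sum_range_le_of_periodic hpos (periodic_finset_prod hper) hbd (by positivity) N ?_).trans
    (add_le_add ?_ ?_)
  · rw [hsum]; split_ifs <;> positivity
  · rw [hsum]
    split_ifs
    · have : ((∏ p ∈ U, p : ℕ) : ℝ) ≠ 0 := by exact_mod_cast hpos.ne'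
      rw [← mul_assoc, div_mul_cancel₀ _ this]
    · simp
  · have : ((∏ p ∈ U, p : ℕ) : ℝ) ≤ z * z := by exact_mod_cast hle
    calc _ ≤ ((z : ℝ) * z) * (z * z) := by gcongr
      _ = _ := by ring

theorem card_filter_prod_le {P : Finset ℕ} (hP : ∀ p ∈ P, p.Prime) (z : ℕ) :
    (P.powerset.filter fun T => ∏ p ∈ T, p ≤ z).card ≤ z := by
  have hp : ∀ T ∈ P.powerset.filter (fun T => ∏ p ∈ T, p ≤ z), ∀ p ∈ T, p.Prime := fun T hT p h =>
    hP p (Finset.mem_powerset.1 (Finset.mem_filter.1 hT).1 h)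
  have : (P.powerset.filter fun T => ∏ p ∈ T, p ≤ z).card ≤ (Finset.Icc 1 z).card := by
    refine Finset.card_le_card_of_injOn (fun T => ∏ p ∈ T, p) ?_ ?_
    · intro T hT
      exact Finset.mem_coe.2 (Finset.mem_Icc.2
        ⟨Finset.prod_pos fun p h => (hp T hT p h).pos, (Finset.mem_filter.1 hT).2⟩)
    · intro T hT T' hT' h
      rw [← Nat.primeFactors_prod (hp T hT), ← Nat.primeFactors_prod (hp T' hT')]
      exact congrArg Nat.primeFactors h
  simpa using this

-- `F`, the sum of the weight products over all admissible `T`, equals the constant `S` on unsifted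
-- `n`, while orthogonality makes its second moment about `N * S`. There are at most `z` sets `T`,
-- hence at most `z²` pairs with error `z⁴` each.
open Classical in
theorem card_sifted_mul_sq_le {h : ℤ} {P : Finset ℕ}
    (hP : ∀ p ∈ P, p.Prime ∧ 3 ≤ p ∧ ¬ (p : ℤ) ∣ h) (z N : ℕ) {S : ℝ}
    (hS : S = ∑ T ∈ P.powerset.filter (fun T => ∏ p ∈ T, p ≤ z), ∏ p ∈ T, (2 / ((p : ℝ) - 2))) :
    (((Finset.range N).filter fun n : ℕ =>
      ∀ p ∈ P, ¬ ((p : ℤ) ∣ n ∨ (p : ℤ) ∣ n + h)).card : ℝ) * S ^ 2 ≤ N * S + (z : ℝ) ^ 6 := by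
  set D := P.powerset.filter (fun T => ∏ p ∈ T, p ≤ z) with hD
  set A := (Finset.range N).filter fun n : ℕ => ∀ p ∈ P, ¬ ((p : ℤ) ∣ n ∨ (p : ℤ) ∣ n + h) with hA
  have hDm : ∀ T ∈ D, (∀ p ∈ T, p.Prime ∧ 3 ≤ p ∧ ¬ (p : ℤ) ∣ h) ∧ ∏ p ∈ T, p ≤ z := by
    intro T hT
    obtain ⟨h1, h2⟩ := Finset.mem_filter.1 hT
    exact ⟨fun p hp => hP p (Finset.mem_powerset.1 h1 hp), h2⟩
  set F : ℕ → ℝ := fun n => ∑ T ∈ D, ∏ p ∈ T, pairWeight h p n with hF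
  have hFA : ∀ n ∈ A, F n = S := by
    intro n hn
    rw [hS]
    refine Finset.sum_congr rfl fun T hT => Finset.prod_congr rfl fun p hp => ?_
    have := (Finset.mem_filter.1 hn).2 p
      (Finset.mem_powerset.1 (Finset.mem_filter.1 hT).1 hp)
    rw [pairWeight, if_neg this]
  have h1 : (A.card : ℝ) * S ^ 2 ≤ ∑ n ∈ Finset.range N, F n ^ 2 := by
    calc (A.card : ℝ) * S ^ 2 = ∑ n ∈ A, F n ^ 2 := by
          rw [Finset.sum_congr rfl fun n hn => by rw [hFA n hn], Finset.sum_const, nsmul_eq_mul]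
      _ ≤ _ := Finset.sum_le_sum_of_subset_of_nonneg (Finset.filter_subset _ _)
          fun _ _ _ => sq_nonneg _
  have h2 : ∑ n ∈ Finset.range N, F n ^ 2 = ∑ T ∈ D, ∑ T' ∈ D, ∑ n ∈ Finset.range N,
      (∏ p ∈ T, pairWeight h p n) * (∏ p ∈ T', pairWeight h p n) := by
    simp only [hF, sq, Finset.sum_mul_sum]
    rw [Finset.sum_comm]
    exact Finset.sum_congr rfl fun T _ => Finset.sum_comm
  have h3 : ∑ T ∈ D, ∑ T' ∈ D, ∑ n ∈ Finset.range N,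
      (∏ p ∈ T, pairWeight h p n) * (∏ p ∈ T', pairWeight h p n)
      ≤ ∑ T ∈ D, ∑ T' ∈ D,
        ((if T = T' then N * ∏ p ∈ T, (2 / ((p : ℝ) - 2)) else 0) + (z : ℝ) ^ 4) :=
    Finset.sum_le_sum fun T hT => Finset.sum_le_sum fun T' hT' =>
      sum_prod_pairWeight_mul_le (hDm T hT).1 (hDm T' hT').1 (hDm T hT).2 (hDm T' hT').2 N
  have h4 : ∑ T ∈ D, ∑ T' ∈ D,
        ((if T = T' then N * ∏ p ∈ T, (2 / ((p : ℝ) - 2)) else 0) + (z : ℝ) ^ 4)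
      = N * S + D.card * D.card * (z : ℝ) ^ 4 := by
    simp only [Finset.sum_add_distrib, Finset.sum_ite_eq, Finset.sum_const, nsmul_eq_mul]
    rw [hS, Finset.mul_sum, Finset.sum_congr rfl fun T hT => if_pos hT]
    ring
  have hc : (D.card : ℝ) ≤ z := by
    exact_mod_cast card_filter_prod_le (fun p hp => (hP p hp).1) z
  calc _ ≤ N * S + D.card * D.card * (z : ℝ) ^ 4 := by
        rw [← h4]; exact h1.trans (h2.le.trans h3)
    _ ≤ N * S + z * z * (z : ℝ) ^ 4 := by gcongr
    _ = _ := by ring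

/-! ### Lower bound for the sieve sum `S` by a squared logarithm. -/

/-- Primes are removed one at a time: dividing a surviving multiple of `q` by `q` gives another
survivor, so these multiples carry at most `1/q` of the sum. -/
theorem prod_one_sub_inv_mul_sum_inv_le {s : Finset ℕ} (hs : ∀ p ∈ s, p.Prime) (y : ℕ) :
    (∏ p ∈ s, (1 - 1 / (p : ℝ))) * ∑ a ∈ Finset.Icc 1 y, 1 / (a : ℝ)
      ≤ ∑ a ∈ (Finset.Icc 1 y).filter (fun a => ∀ p ∈ s, ¬ p ∣ a), 1 / (a : ℝ) := by
  induction s using Finset.induction_on with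
  | empty => simp
  | insert q s hq ih =>
    have hqp := hs q (Finset.mem_insert_self _ _)
    have hs' : ∀ p ∈ s, p.Prime := fun p hp => hs p (Finset.mem_insert_of_mem hp)
    have hq1 : (1 : ℝ) ≤ q := by exact_mod_cast hqp.one_le
    have hq0 : 0 ≤ 1 - 1 / (q : ℝ) := by
      rw [sub_nonneg, div_le_one (by linarith)]; exact hq1
    set A := (Finset.Icc 1 y).filter (fun a => ∀ p ∈ s, ¬ p ∣ a) with hA
    have hsplit := Finset.sum_filter_add_sum_filter_not A (fun a => q ∣ a) (fun a => 1 / (a : ℝ))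
    have hmul : ∑ a ∈ A.filter (fun a => q ∣ a), 1 / (a : ℝ) ≤ 1 / q * ∑ a ∈ A, 1 / (a : ℝ) := by
      have hinj : Set.InjOn (fun a => a / q) (A.filter (fun a => q ∣ a) : Finset ℕ) := by
        intro a ha b hb hab
        have ha := (Finset.mem_filter.1 ha).2
        have hb := (Finset.mem_filter.1 hb).2
        rw [← Nat.div_mul_cancel ha, ← Nat.div_mul_cancel hb]
        exact congrArg (· * q) hab
      calc ∑ a ∈ A.filter (fun a => q ∣ a), 1 / (a : ℝ)
          = ∑ a ∈ A.filter (fun a => q ∣ a), 1 / q * (1 / ((a / q : ℕ) : ℝ)) := by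
            refine Finset.sum_congr rfl fun a ha => ?_
            have ha := (Finset.mem_filter.1 ha).2
            rw [one_div_mul_one_div, ← Nat.cast_mul, Nat.mul_div_cancel' ha]
        _ = 1 / q * ∑ b ∈ (A.filter (fun a => q ∣ a)).image (fun a => a / q), 1 / (b : ℝ) := by
            rw [Finset.sum_image hinj, Finset.mul_sum]
        _ ≤ 1 / q * ∑ a ∈ A, 1 / (a : ℝ) := by
            refine mul_le_mul_of_nonneg_left
              (Finset.sum_le_sum_of_subset_of_nonneg ?_ fun _ _ _ => by positivity) (by positivity)
            intro b hb
            obtain ⟨a, ha, rfl⟩ := Finset.mem_image.1 hb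
            obtain ⟨ha, c, rfl⟩ := Finset.mem_filter.1 ha
            obtain ⟨h1, h2⟩ := Finset.mem_filter.1 ha
            obtain ⟨h3, h4⟩ := Finset.mem_Icc.1 h1
            have hc : 0 < c := Nat.pos_of_mul_pos_left h3
            rw [Nat.mul_div_cancel_left c hqp.pos]
            exact Finset.mem_filter.2 ⟨Finset.mem_Icc.2
              ⟨hc, (Nat.le_mul_of_pos_left c hqp.pos).trans h4⟩,
              fun p hp hd => h2 p hp (hd.mul_left q)⟩
    have hset : (Finset.Icc 1 y).filter (fun a => ∀ p ∈ insert q s, ¬ p ∣ a)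
        = A.filter (fun a => ¬ q ∣ a) := by
      ext a
      simp only [hA, Finset.mem_filter, Finset.mem_insert, forall_eq_or_imp]
      tauto
    rw [Finset.prod_insert hq, hset, mul_assoc]
    calc _ ≤ (1 - 1 / (q : ℝ)) * ∑ a ∈ A, 1 / (a : ℝ) :=
          mul_le_mul_of_nonneg_left (ih hs') hq0
      _ ≤ _ := by linarith

theorem card_divisors_prime_mul_le {p : ℕ} (hp : p.Prime) (n : ℕ) :
    (p * n).divisors.card ≤ 2 * n.divisors.card := by
  rw [Nat.divisors_mul]
  refine Finset.card_mul_le.trans ?_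
  rw [hp.divisors, Finset.card_pair hp.one_lt.ne]

/-- The local series of `d(n)/n` at `p` is compared with `2/(p-2)` without evaluating it, through a
self-referential inequality. -/
theorem sum_card_divisors_div_primeFactors_eq_le {T : Finset ℕ} (hT : ∀ p ∈ T, p.Prime ∧ 3 ≤ p)
    (z : ℕ) :
    ∑ n ∈ (Finset.Icc 1 z).filter (fun n => n.primeFactors = T), (n.divisors.card : ℝ) / n
      ≤ ∏ p ∈ T, (2 / ((p : ℝ) - 2)) := by
  induction T using Finset.induction_on with
  | empty =>
    have hsub : (Finset.Icc 1 z).filter (fun n => n.primeFactors = ∅) ⊆ {1} := by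
      intro n hn
      obtain ⟨h1, h2⟩ := Finset.mem_filter.1 hn
      have := (Finset.mem_Icc.1 h1).1
      rcases Nat.primeFactors_eq_empty.1 h2 with h | h
      · omega
      · simp [h]
    refine (Finset.sum_le_sum_of_subset_of_nonneg hsub fun _ _ _ => by positivity).trans ?_
    simp
  | insert q T hq ih =>
    obtain ⟨hqp, hq3⟩ := hT q (Finset.mem_insert_self _ _)
    have ih := ih fun p hp => hT p (Finset.mem_insert_of_mem hp)
    have h3 : (3 : ℝ) ≤ q := by exact_mod_cast hq3
    set f : ℕ → ℝ := fun n => (n.divisors.card : ℝ) / n with hf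
    set A := (Finset.Icc 1 z).filter (fun n => n.primeFactors = insert q T) with hA
    set B := (Finset.Icc 1 z).filter (fun n => n.primeFactors = T) with hB
    have hdisj : Disjoint A B := by
      rw [Finset.disjoint_filter]
      intro n _ h1 h2
      exact hq (h2 ▸ h1 ▸ Finset.mem_insert_self q T)
    have hdvd : ∀ n ∈ A, q ∣ n := fun n hn =>
      Nat.dvd_of_mem_primeFactors ((Finset.mem_filter.1 hn).2 ▸ Finset.mem_insert_self q T)
    have hinj : Set.InjOn (fun a => a / q) A := by
      intro a ha b hb hab
      rw [← Nat.div_mul_cancel (hdvd a ha), ← Nat.div_mul_cancel (hdvd b hb)]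
      exact congrArg (· * q) hab
    -- Division by `q` maps `A` into `A ∪ B`, according to whether `q` still divides the quotient,
    -- and at most halves the divisor count. Solving for the sum over `A` turns `2/q` into
    -- `2/(q-2)`.
    have hmain : ∑ n ∈ A, f n ≤ 2 / q * (∑ n ∈ A, f n + ∑ n ∈ B, f n) := by
      calc ∑ n ∈ A, f n ≤ ∑ n ∈ A, 2 / q * f (n / q) := by
            refine Finset.sum_le_sum fun n hn => ?_
            obtain ⟨c, rfl⟩ := hdvd n hn
            rw [Nat.mul_div_cancel_left c hqp.pos]
            simp only [hf]
            rw [div_mul_div_comm, Nat.cast_mul]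
            gcongr
            exact_mod_cast card_divisors_prime_mul_le hqp c
        _ = 2 / q * ∑ b ∈ A.image (fun a => a / q), f b := by
            rw [Finset.sum_image hinj, Finset.mul_sum]
        _ ≤ 2 / q * ∑ b ∈ A ∪ B, f b := by
            refine mul_le_mul_of_nonneg_left
              (Finset.sum_le_sum_of_subset_of_nonneg ?_ fun _ _ _ => by positivity) (by positivity)
            intro b hb
            obtain ⟨a, ha, rfl⟩ := Finset.mem_image.1 hb
            obtain ⟨c, rfl⟩ := hdvd a ha
            obtain ⟨h1, h2⟩ := Finset.mem_filter.1 ha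
            obtain ⟨h4, h5⟩ := Finset.mem_Icc.1 h1
            have hc : 0 < c := Nat.pos_of_mul_pos_left h4
            rw [Nat.mul_div_cancel_left c hqp.pos]
            have hmem : c ∈ Finset.Icc 1 z :=
              Finset.mem_Icc.2 ⟨hc, (Nat.le_mul_of_pos_left c hqp.pos).trans h5⟩
            rw [Nat.primeFactors_mul hqp.ne_zero hc.ne', hqp.primeFactors,
              Finset.singleton_union] at h2
            rw [Finset.mem_union, hA, hB, Finset.mem_filter, Finset.mem_filter]
            by_cases hqc : q ∈ c.primeFactors
            · left
              exact ⟨hmem, by rw [← h2, Finset.insert_eq_of_mem hqc]⟩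
            · right
              refine ⟨hmem, ?_⟩
              rw [← Finset.erase_insert hqc, h2, Finset.erase_insert hq]
        _ = _ := by rw [Finset.sum_union hdisj]
    rw [Finset.prod_insert hq]
    have h0 : (0 : ℝ) < q - 2 := by linarith
    have hq0 : (0 : ℝ) < q := by linarith
    have hAB : ∑ n ∈ A, f n ≤ 2 / ((q : ℝ) - 2) * ∑ n ∈ B, f n := by
      rw [div_mul_eq_mul_div, le_div_iff₀ hq0] at hmain
      rw [div_mul_eq_mul_div, le_div_iff₀ h0]
      linarith
    exact hAB.trans (mul_le_mul_of_nonneg_left ih (by positivity))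

theorem sq_sum_inv_filter_le {s : Finset ℕ} (hs : ∀ p ∈ s, p.Prime) (y : ℕ) :
    (∑ a ∈ (Finset.Icc 1 y).filter (fun a => ∀ p ∈ s, ¬ p ∣ a), 1 / (a : ℝ)) ^ 2
      ≤ ∑ n ∈ (Finset.Icc 1 (y * y)).filter (fun n => ∀ p ∈ s, ¬ p ∣ n),
        (n.divisors.card : ℝ) / n := by
  set A := (Finset.Icc 1 y).filter (fun a => ∀ p ∈ s, ¬ p ∣ a) with hA
  set B := (Finset.Icc 1 (y * y)).filter (fun n => ∀ p ∈ s, ¬ p ∣ n) with hB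
  have hmaps : ∀ q ∈ A ×ˢ A, q.1 * q.2 ∈ B := by
    rintro ⟨a, b⟩ hq
    obtain ⟨ha, hb⟩ := Finset.mem_product.1 hq
    simp only [hA, hB, Finset.mem_filter, Finset.mem_Icc] at ha hb ⊢
    exact ⟨⟨Nat.mul_pos ha.1.1 hb.1.1, Nat.mul_le_mul ha.1.2 hb.1.2⟩,
      fun p hp hd => ((hs p hp).dvd_mul.1 hd).elim (ha.2 p hp) (hb.2 p hp)⟩
  rw [sq, Finset.sum_mul_sum, ← Finset.sum_product',
    ← Finset.sum_fiberwise_of_maps_to (g := fun q : ℕ × ℕ => q.1 * q.2) hmaps]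
  refine Finset.sum_le_sum fun n hn => ?_
  have hn0 : n ≠ 0 := by
    have := (Finset.mem_Icc.1 (Finset.mem_filter.1 hn).1).1
    omega
  calc ∑ q ∈ (A ×ˢ A).filter (fun q => q.1 * q.2 = n), 1 / (q.1 : ℝ) * (1 / (q.2 : ℝ))
      = ∑ q ∈ (A ×ˢ A).filter (fun q => q.1 * q.2 = n), 1 / (n : ℝ) := by
        refine Finset.sum_congr rfl fun q hq => ?_
        rw [one_div_mul_one_div, ← Nat.cast_mul, (Finset.mem_filter.1 hq).2]
    _ = ((A ×ˢ A).filter (fun q => q.1 * q.2 = n)).card * (1 / (n : ℝ)) := by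
        rw [Finset.sum_const, nsmul_eq_mul]
    _ ≤ n.divisors.card * (1 / (n : ℝ)) := by
        gcongr
        refine Finset.card_le_card_of_injOn Prod.fst ?_ ?_
        · intro q hq
          exact Nat.mem_divisors.2 ⟨⟨q.2, (Finset.mem_filter.1 hq).2.symm⟩, hn0⟩
        · intro q hq r hr hqr
          have hq := (Finset.mem_filter.1 hq).2
          have hr := (Finset.mem_filter.1 hr).2
          have hq0 : 0 < q.1 := Nat.pos_of_ne_zero fun h => hn0 (by rw [← hq, h, zero_mul])
          refine Prod.ext hqr (Nat.eq_of_mul_eq_mul_left hq0 ?_)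
          rw [hq, ← hr, hqr]
    _ = _ := by ring

/-- Integers are grouped by their set of prime factors, whose product is at most `n ≤ z`. Having `2
∈ s` keeps every `p - 2` positive. -/
theorem sum_card_divisors_div_le_sum_prod {s : Finset ℕ} (hs2 : 2 ∈ s) (z : ℕ) :
    ∑ n ∈ (Finset.Icc 1 z).filter (fun n => ∀ p ∈ s, ¬ p ∣ n), (n.divisors.card : ℝ) / n
      ≤ ∑ T ∈ (((Finset.Icc 1 z).filter fun p => p.Prime ∧ p ∉ s).powerset.filter
          (fun T => ∏ p ∈ T, p ≤ z)), ∏ p ∈ T, (2 / ((p : ℝ) - 2)) := by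
  set B := (Finset.Icc 1 z).filter (fun n => ∀ p ∈ s, ¬ p ∣ n) with hB
  set D := ((Finset.Icc 1 z).filter fun p => p.Prime ∧ p ∉ s).powerset.filter
          (fun T => ∏ p ∈ T, p ≤ z) with hD
  have hmaps : ∀ n ∈ B, n.primeFactors ∈ D := by
    intro n hn
    obtain ⟨h1, h2⟩ := Finset.mem_filter.1 hn
    obtain ⟨h3, h4⟩ := Finset.mem_Icc.1 h1
    refine Finset.mem_filter.2 ⟨Finset.mem_powerset.2 fun p hp => ?_, ?_⟩
    · have hpp := Nat.prime_of_mem_primeFactors hp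
      have hpd := Nat.dvd_of_mem_primeFactors hp
      exact Finset.mem_filter.2 ⟨Finset.mem_Icc.2 ⟨hpp.one_le, (Nat.le_of_dvd h3 hpd).trans h4⟩,
        hpp, fun hps => h2 p hps hpd⟩
    · exact (Nat.le_of_dvd h3 (Nat.prod_primeFactors_dvd n)).trans h4
  rw [← Finset.sum_fiberwise_of_maps_to hmaps]
  refine Finset.sum_le_sum fun T hT => ?_
  refine le_trans ?_ (sum_card_divisors_div_primeFactors_eq_le (z := z) fun p hp => ?_)
  · refine Finset.sum_le_sum_of_subset_of_nonneg ?_ fun _ _ _ => by positivity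
    intro n hn
    obtain ⟨h1, h2⟩ := Finset.mem_filter.1 hn
    exact Finset.mem_filter.2 ⟨(Finset.mem_filter.1 h1).1, h2⟩
  · have h1 := Finset.mem_powerset.1 (Finset.mem_filter.1 hT).1 hp
    obtain ⟨h2, h3⟩ := (Finset.mem_filter.1 h1).2
    refine ⟨h2, ?_⟩
    have := h2.two_le
    have : p ≠ 2 := fun h => h3 (h ▸ hs2)
    omega

theorem sq_prod_mul_log_le_sum_prod {s : Finset ℕ} (hs : ∀ p ∈ s, p.Prime) (hs2 : 2 ∈ s) (y : ℕ) :
    ((∏ p ∈ s, (1 - 1 / (p : ℝ))) * Real.log (y + 1)) ^ 2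
      ≤ ∑ T ∈ (((Finset.Icc 1 (y * y)).filter fun p => p.Prime ∧ p ∉ s).powerset.filter
          (fun T => ∏ p ∈ T, p ≤ y * y)), ∏ p ∈ T, (2 / ((p : ℝ) - 2)) := by
  refine le_trans ?_ ((sq_sum_inv_filter_le hs y).trans (sum_card_divisors_div_le_sum_prod hs2 _))
  have hh : Real.log (y + 1) ≤ ∑ a ∈ Finset.Icc 1 y, 1 / (a : ℝ) := by
    have := log_add_one_le_harmonic y
    rw [harmonic_eq_sum_Icc] at this
    simpa using this
  have h0 : 0 ≤ ∏ p ∈ s, (1 - 1 / (p : ℝ)) := Finset.prod_nonneg fun p hp => by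
    have : (1 : ℝ) ≤ p := by exact_mod_cast (hs p hp).one_le
    rw [sub_nonneg, div_le_one (by linarith)]; exact this
  have hlog : 0 ≤ Real.log (y + 1) := Real.log_nonneg (by linarith [(Nat.cast_nonneg y : (0:ℝ) ≤ y)])
  gcongr
  exact (mul_le_mul_of_nonneg_left hh h0).trans (prod_one_sub_inv_mul_sum_inv_le hs y)

/-! ### Prime pairs with a given difference. -/

/-- The constant 6 is sharp: the local inequality is an equality at `p = 2`. -/
theorem inv_sq_prod_one_sub_inv_le {s : Finset ℕ} (hs : ∀ p ∈ s, p.Prime) :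
    0 < ∏ p ∈ s, (1 - 1 / (p : ℝ)) ∧
      1 / (∏ p ∈ s, (1 - 1 / (p : ℝ))) ^ 2 ≤ ∏ p ∈ s, (1 + 6 / (p : ℝ)) := by
  have h2 : ∀ p ∈ s, (2 : ℝ) ≤ p := fun p hp => by exact_mod_cast (hs p hp).two_le
  have hpos : ∀ p ∈ s, 0 < 1 - 1 / (p : ℝ) := fun p hp => by
    have := h2 p hp
    rw [sub_pos, div_lt_one (by linarith)]; linarith
  refine ⟨Finset.prod_pos hpos, ?_⟩
  rw [← Finset.prod_pow, one_div, ← Finset.prod_inv_distrib]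
  refine Finset.prod_le_prod (fun p hp => (inv_pos.2 (pow_pos (hpos p hp) 2)).le) fun p hp => ?_
  have := h2 p hp
  have hp0 : (p : ℝ) ≠ 0 := by linarith
  rw [inv_le_iff_one_le_mul₀ (pow_pos (hpos p hp) 2)]
  have e : (1 + 6 / (p : ℝ)) * (1 - 1 / (p : ℝ)) ^ 2 - 1
      = (p - 2) * (4 * p - 3) / p ^ 3 := by
    field_simp; ring
  have : 0 ≤ ((p : ℝ) - 2) * (4 * p - 3) / p ^ 3 :=
    div_nonneg (mul_nonneg (by linarith) (by linarith)) (by positivity)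
  linarith

theorem sqrt_le_mul_div_log_sq {x : ℝ} (hx : 1 < x) : √x ≤ 16 * (x / Real.log x ^ 2) := by
  have hl := Real.log_pos hx
  have h1 := Real.log_le_rpow_div (by linarith : 0 ≤ x) (by norm_num : (0 : ℝ) < 1 / 4)
  have h2 : Real.log x ^ 2 ≤ 16 * √x := by
    calc Real.log x ^ 2 ≤ (x ^ (1 / 4 : ℝ) / (1 / 4)) ^ 2 := by gcongr
      _ = 16 * (x ^ (1 / 4 : ℝ)) ^ 2 := by ring
      _ = 16 * √x := by
        rw [← Real.rpow_natCast, ← Real.rpow_mul (by linarith), Real.sqrt_eq_rpow]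
        norm_num
  rw [← mul_div_assoc, le_div_iff₀ (by positivity)]
  calc √x * Real.log x ^ 2 ≤ √x * (16 * √x) := by gcongr
    _ = 16 * (√x * √x) := by ring
    _ = 16 * x := by rw [Real.mul_self_sqrt (by linarith)]

-- If `n` and `n + h` are both primes exceeding `z`, no sieving prime divides either; each of the
-- two exceptional cases accounts for at most `z` values of `n`.
open Classical in
theorem card_prime_and_prime_add_le_card_sifted {h : ℤ} (z N : ℕ) {P : Finset ℕ}
    (hP : ∀ p ∈ P, p.Prime ∧ p ≤ z) :
    ((Finset.range N).filter fun n : ℕ => n.Prime ∧ ((n : ℤ) + h).toNat.Prime).card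
      ≤ ((Finset.range N).filter fun n : ℕ =>
        ∀ p ∈ P, ¬ ((p : ℤ) ∣ n ∨ (p : ℤ) ∣ n + h)).card + 2 * z := by
  set A := (Finset.range N).filter fun n : ℕ => ∀ p ∈ P, ¬ ((p : ℤ) ∣ n ∨ (p : ℤ) ∣ n + h) with hA
  set B := (Finset.range N).filter fun n : ℕ => n.Prime ∧ ((n : ℤ) + h).toNat.Prime with hB
  have hsub : B ⊆ A ∪ (Finset.Icc 1 z ∪ B.filter fun n : ℕ => ((n : ℤ) + h).toNat ≤ z) := by
    intro n hn
    obtain ⟨h1, h2, h3⟩ := Finset.mem_filter.1 hn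
    by_cases hz : n ≤ z
    · exact Finset.mem_union_right _ (Finset.mem_union_left _
        (Finset.mem_Icc.2 ⟨h2.one_le, hz⟩))
    by_cases hz' : ((n : ℤ) + h).toNat ≤ z
    · exact Finset.mem_union_right _ (Finset.mem_union_right _ (Finset.mem_filter.2 ⟨hn, hz'⟩))
    refine Finset.mem_union_left _ (Finset.mem_filter.2 ⟨h1, fun p hp hd => ?_⟩)
    obtain ⟨hpp, hpz⟩ := hP p hp
    rcases hd with hd | hd
    · have : p = n := (Nat.prime_dvd_prime_iff_eq hpp h2).1 (by exact_mod_cast hd)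
      omega
    · have hnn : ((((n : ℤ) + h).toNat : ℕ) : ℤ) = n + h := by
        have := h3.pos
        omega
      rw [← hnn] at hd
      have := (Nat.prime_dvd_prime_iff_eq hpp h3).1 (by exact_mod_cast hd)
      omega
  have hC : (B.filter fun n : ℕ => ((n : ℤ) + h).toNat ≤ z).card ≤ (Finset.Icc 1 z).card := by
    refine Finset.card_le_card_of_injOn (fun n : ℕ => ((n : ℤ) + h).toNat) ?_ ?_
    · intro n hn
      obtain ⟨h1, h2⟩ := Finset.mem_filter.1 hn
      exact Finset.mem_coe.2 (Finset.mem_Icc.2 ⟨(Finset.mem_filter.1 h1).2.2.pos, h2⟩)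
    · intro n hn m hm hnm
      have h1 := (Finset.mem_filter.1 (Finset.mem_filter.1 hn).1).2.2.pos
      have h2 := (Finset.mem_filter.1 (Finset.mem_filter.1 hm).1).2.2.pos
      dsimp only at hnm
      omega
  have h1 := Finset.card_le_card hsub
  have h2 := Finset.card_union_le A (Finset.Icc 1 z ∪ B.filter fun n : ℕ => ((n : ℤ) + h).toNat ≤ z)
  have h3 := Finset.card_union_le (Finset.Icc 1 z) (B.filter fun n : ℕ => ((n : ℤ) + h).toNat ≤ z)
  rw [Nat.card_Icc] at hC h3
  omega

/-- Upper bound sieve for prime pairs, uniform in the difference. -/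
theorem card_prime_and_prime_add_le {h : ℤ} (hh : h ≠ 0) {N : ℕ} (hN : 2 ≤ N) :
    (((Finset.range N).filter fun n : ℕ => n.Prime ∧ ((n : ℤ) + h).toNat.Prime).card : ℝ)
      ≤ 624 * (N / Real.log N ^ 2) * ∏ p ∈ (2 * h).natAbs.primeFactors, (1 + 6 / (p : ℝ)) := by
  classical
  set s := (2 * h).natAbs.primeFactors with hs
  have hsp : ∀ p ∈ s, p.Prime := fun p hp => Nat.prime_of_mem_primeFactors hp
  have h2h : (2 * h).natAbs ≠ 0 := by omega
  -- The factor 2 in `2 * h` puts the prime 2 among the excluded primes even when `h` is odd.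
  have hs2 : 2 ∈ s := Nat.mem_primeFactors.2 ⟨Nat.prime_two, by omega, h2h⟩
  have hN1 : (1 : ℝ) < N := by exact_mod_cast hN
  have hN0 : (0 : ℝ) < N := by linarith
  have hlog := Real.log_pos hN1
  -- With level `z = y²` the sieve error `z⁶ = y¹²` is at most `√N`.
  set y := ⌊(N : ℝ) ^ (1 / 24 : ℝ)⌋₊ with hy
  have hy1 : 1 ≤ y := Nat.le_floor (by
    simpa using Real.one_le_rpow hN1.le (by norm_num : (0 : ℝ) ≤ 1 / 24))
  have hy12 : (y : ℝ) ^ 12 ≤ √N := by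
    calc (y : ℝ) ^ 12 ≤ ((N : ℝ) ^ (1 / 24 : ℝ)) ^ 12 := by
          gcongr
          exact Nat.floor_le (by positivity)
      _ = √N := by
        rw [← Real.rpow_natCast, ← Real.rpow_mul hN0.le, Real.sqrt_eq_rpow]
        norm_num
  have hylog : Real.log N / 24 ≤ Real.log (y + 1) := by
    calc Real.log N / 24 = Real.log ((N : ℝ) ^ (1 / 24 : ℝ)) := by
          rw [Real.log_rpow hN0]; ring
      _ ≤ _ := Real.log_le_log (by positivity) (Nat.lt_floor_add_one _).le
  set P := (Finset.Icc 1 (y * y)).filter fun p => p.Prime ∧ p ∉ s with hP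
  have hPm : ∀ p ∈ P, p.Prime ∧ 3 ≤ p ∧ ¬ (p : ℤ) ∣ h := by
    intro p hp
    obtain ⟨-, h1, h2⟩ := Finset.mem_filter.1 hp
    have hp2 := h1.two_le
    have hne : p ≠ 2 := fun h => h2 (h ▸ hs2)
    refine ⟨h1, by omega, fun hd => h2 (Nat.mem_primeFactors.2 ⟨h1, ?_, h2h⟩)⟩
    exact Int.natCast_dvd.1 (hd.mul_left 2)
  have hPz : ∀ p ∈ P, p.Prime ∧ p ≤ y * y := fun p hp =>
    ⟨(hPm p hp).1, (Finset.mem_Icc.1 (Finset.mem_filter.1 hp).1).2⟩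
  obtain ⟨S, hS⟩ : ∃ S : ℝ, S = ∑ T ∈ P.powerset.filter (fun T => ∏ p ∈ T, p ≤ y * y),
    ∏ p ∈ T, (2 / ((p : ℝ) - 2)) := ⟨_, rfl⟩
  have hcard := card_prime_and_prime_add_le_card_sifted (h := h) (y * y) N hPz
  have hsift := card_sifted_mul_sq_le hPm (y * y) N hS
  have hSlow := sq_prod_mul_log_le_sum_prod hsp hs2 y
  rw [← hP, ← hS] at hSlow
  set A := (Finset.range N).filter fun n : ℕ => ∀ p ∈ P, ¬ ((p : ℤ) ∣ n ∨ (p : ℤ) ∣ n + h) with hA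
  have hS1 : 1 ≤ S := by
    rw [hS]
    refine le_trans (by simp) (Finset.single_le_sum (f := fun T : Finset ℕ =>
      ∏ p ∈ T, (2 / ((p : ℝ) - 2))) (a := ∅) ?_ ?_)
    · intro T hT
      refine Finset.prod_nonneg fun p hp => ?_
      have : (3 : ℝ) ≤ p := by
        exact_mod_cast (hPm p (Finset.mem_powerset.1 (Finset.mem_filter.1 hT).1 hp)).2.1
      exact div_nonneg (by norm_num) (by linarith)
    · exact Finset.mem_filter.2 ⟨Finset.empty_mem_powerset _, by
        rw [Finset.prod_empty]; exact Nat.mul_pos hy1 hy1⟩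
  obtain ⟨hW0, hW⟩ := inv_sq_prod_one_sub_inv_le hsp
  set w := ∏ p ∈ s, (1 - 1 / (p : ℝ)) with hw
  set W := ∏ p ∈ s, (1 + 6 / (p : ℝ)) with hWdef
  have hW1 : 1 ≤ W := by
    rw [hWdef]
    have := Finset.prod_le_prod (s := s) (f := fun _ : ℕ => (1 : ℝ)) (g := fun p : ℕ => 1 + 6 / (p : ℝ))
      (fun _ _ => zero_le_one) fun (p : ℕ) _ => by
        have : 0 ≤ 6 / (p : ℝ) := by positivity
        linarith
    simpa using this
  have hNS : N / S ≤ 576 * (N / Real.log N ^ 2) * W := by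
    have h1 : (w * (Real.log N / 24)) ^ 2 ≤ S := by
      refine le_trans ?_ hSlow
      gcongr
    calc N / S ≤ N / (w * (Real.log N / 24)) ^ 2 := by gcongr
      _ = 576 * (N / Real.log N ^ 2) * (1 / w ^ 2) := by
        field_simp; norm_num
      _ ≤ _ := by gcongr
  have hAcard : (A.card : ℝ) ≤ N / S + (y : ℝ) ^ 12 := by
    have hSpos : 0 < S := by linarith
    have : (A.card : ℝ) ≤ (N * S + ((y * y : ℕ) : ℝ) ^ 6) / S ^ 2 := by
      rw [le_div_iff₀ (by positivity)]; exact hsift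
    refine this.trans ?_
    rw [add_div]
    refine add_le_add (le_of_eq (by field_simp)) ?_
    rw [div_le_iff₀ (by positivity)]
    have e : ((y * y : ℕ) : ℝ) ^ 6 = (y : ℝ) ^ 12 := by push_cast; ring
    rw [e]
    exact le_mul_of_one_le_right (by positivity) (one_le_pow₀ hS1)
  have hy2 : ((y * y : ℕ) : ℝ) ≤ (y : ℝ) ^ 12 := by
    have : y * y ≤ y ^ 12 := by
      rw [← sq]; exact Nat.pow_le_pow_right hy1 (by norm_num)
    exact_mod_cast this
  have hsq := sqrt_le_mul_div_log_sq hN1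
  have hcard' : (((Finset.range N).filter fun n : ℕ => n.Prime ∧ ((n : ℤ) + h).toNat.Prime).card : ℝ)
      ≤ A.card + 2 * ((y * y : ℕ) : ℝ) := by exact_mod_cast hcard
  have hX : 0 ≤ N / Real.log N ^ 2 := by positivity
  have hXW : N / Real.log N ^ 2 ≤ N / Real.log N ^ 2 * W := le_mul_of_one_le_right hX hW1
  -- `624 = 576 + 3 * 16`: the main term gives `24² = 576`; the sieve error and the `2z` small cases
  -- give three times `√N`, each at most `16 N / log² N`.
  linarith

/-! ### The singular series on average over polynomial values. -/

-- If `p` divides the leading coefficient then `p` is at most that coefficient; otherwise the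
-- reduction mod `p` is nonzero and its roots are bounded by the degree. The bound ignores the lower
-- coefficients, which later gives uniformity in shifts of `R`.
open Polynomial in
open Classical in
theorem card_range_filter_dvd_eval_le {f : ℤ[X]} (hdeg : 1 ≤ f.natDegree)
    (hlead : 0 < f.leadingCoeff) {p : ℕ} (hp : p.Prime) :
    ((Finset.range p).filter fun b : ℕ => (p : ℤ) ∣ f.eval (b : ℤ)).card
      ≤ f.natDegree + f.leadingCoeff.toNat := by
  have := Fact.mk hp
  by_cases hd : (p : ℤ) ∣ f.leadingCoeff
  · have h1 := Int.le_of_dvd hlead hd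
    have h2 := Finset.card_filter_le (Finset.range p) fun b : ℕ => (p : ℤ) ∣ f.eval (b : ℤ)
    rw [Finset.card_range] at h2
    omega
  · set g := f.map (Int.castRingHom (ZMod p)) with hg
    have hg0 : g ≠ 0 := by
      intro h0
      apply hd
      have := congrArg (fun q : (ZMod p)[X] => q.coeff f.natDegree) h0
      simp only [hg, coeff_map, coeff_zero, coeff_natDegree, eq_intCast] at this
      exact (ZMod.intCast_zmod_eq_zero_iff_dvd _ _).1 this
    have : ((Finset.range p).filter fun b : ℕ => (p : ℤ) ∣ f.eval (b : ℤ)).card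
        ≤ g.roots.toFinset.card := by
      refine Finset.card_le_card_of_injOn (fun b : ℕ => (b : ZMod p)) ?_ ?_
      · intro b hb
        have hb := (Finset.mem_filter.1 hb).2
        rw [Finset.mem_coe, Multiset.mem_toFinset, mem_roots hg0, IsRoot.def, hg]
        have h3 := (ZMod.intCast_zmod_eq_zero_iff_dvd (f.eval (b : ℤ)) p).2 hb
        have h4 : (f.map (Int.castRingHom (ZMod p))).eval ((Int.castRingHom (ZMod p)) (b : ℤ))
            = (Int.castRingHom (ZMod p)) (f.eval (b : ℤ)) := eval_map_apply _ _
        simpa only [h3, eq_intCast, Int.cast_natCast] using h4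
      · intro a ha b hb hab
        have ha := Finset.mem_range.1 (Finset.mem_filter.1 ha).1
        have hb := Finset.mem_range.1 (Finset.mem_filter.1 hb).1
        have := (ZMod.natCast_eq_natCast_iff' a b p).1 hab
        rwa [Nat.mod_eq_of_lt ha, Nat.mod_eq_of_lt hb] at this
    have h5 := Multiset.toFinset_card_le g.roots
    have h6 := card_roots' g
    have h7 : g.natDegree ≤ f.natDegree := natDegree_map_le
    omega

open Polynomial in
open Classical in
theorem card_range_filter_prod_dvd_eval_le {f : ℤ[X]} (hdeg : 1 ≤ f.natDegree)
    (hlead : 0 < f.leadingCoeff) {T : Finset ℕ} (hT : ∀ p ∈ T, p.Prime) {J : ℕ}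
    (hJ : ∏ p ∈ T, p ≤ J) :
    (((Finset.range J).filter fun b : ℕ => ∀ p ∈ T, (p : ℤ) ∣ f.eval (b : ℤ)).card : ℝ)
      ≤ 2 * J * ∏ p ∈ T, (((f.natDegree + f.leadingCoeff.toNat : ℕ) : ℝ) / p) := by
  set K := f.natDegree + f.leadingCoeff.toNat with hK
  set q := ∏ p ∈ T, p with hq
  have hqpos : 0 < q := Finset.prod_pos fun p hp => (hT p hp).pos
  have hqR : (0 : ℝ) < q := by exact_mod_cast hqpos
  set w : ℕ → ℕ → ℝ := fun p b => if (p : ℤ) ∣ f.eval (b : ℤ) then 1 else 0 with hw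
  have hper : ∀ p ∈ T, Function.Periodic (w p) p := by
    intro p _ n
    have : (p : ℤ) ∣ f.eval ((n + p : ℕ) : ℤ) ↔ (p : ℤ) ∣ f.eval (n : ℤ) := by
      refine dvd_iff_dvd_of_dvd_sub ?_
      have := sub_dvd_eval_sub ((n + p : ℕ) : ℤ) (n : ℤ) f
      simpa using this
    simp only [hw, this]
  have hprod : ∀ b, ∏ p ∈ T, w p b = if ∀ p ∈ T, (p : ℤ) ∣ f.eval (b : ℤ) then 1 else 0 := by
    intro b
    simp only [hw]
    rw [Finset.prod_ite_zero]
    simp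
  have hcount : (((Finset.range J).filter fun b : ℕ =>
      ∀ p ∈ T, (p : ℤ) ∣ f.eval (b : ℤ)).card : ℝ) = ∑ b ∈ Finset.range J, ∏ p ∈ T, w p b := by
    simp only [hprod]
    rw [Finset.sum_ite, Finset.sum_const_zero, add_zero, Finset.sum_const, nsmul_one]
  have hsum : ∑ b ∈ Finset.range q, ∏ p ∈ T, w p b ≤ ∏ p ∈ T, (K : ℝ) := by
    rw [hq, sum_range_prod_of_periodic hT hper]
    refine Finset.prod_le_prod (fun p _ => Finset.sum_nonneg fun b _ => ?_) fun p hp => ?_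
    · simp only [hw]; split_ifs <;> norm_num
    · simp only [hw]
      rw [Finset.sum_ite, Finset.sum_const_zero, add_zero, Finset.sum_const, nsmul_one]
      exact_mod_cast card_range_filter_dvd_eval_le hdeg hlead (hT p hp)
  have hnn : ∀ b, 0 ≤ ∏ p ∈ T, w p b := fun b => by rw [hprod]; split_ifs <;> norm_num
  -- Since `q ≤ J`, rounding `J` up to a multiple of the period costs at most a factor 2.
  have hle : J ≤ q * (J / q + 1) := by
    have := Nat.lt_mul_div_succ J hqpos
    exact this.le
  rw [hcount]
  calc ∑ b ∈ Finset.range J, ∏ p ∈ T, w p b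
      ≤ ∑ b ∈ Finset.range (q * (J / q + 1) + 0), ∏ p ∈ T, w p b :=
        Finset.sum_le_sum_of_subset_of_nonneg (Finset.range_subset_range.2 hle) fun b _ _ => hnn b
    _ = ((J / q + 1 : ℕ) : ℝ) * ∑ b ∈ Finset.range q, ∏ p ∈ T, w p b := by
        rw [hq, sum_range_mul_add_of_periodic (periodic_finset_prod hper), Finset.sum_range_zero,
          add_zero]
    _ ≤ (2 * J / q) * ∏ p ∈ T, (K : ℝ) := by
        refine mul_le_mul ?_ hsum (Finset.sum_nonneg fun b _ => hnn b) (by positivity)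
        have h1 : ((J / q : ℕ) : ℝ) ≤ J / q := Nat.cast_div_le
        have h2 : (1 : ℝ) ≤ J / q := by
          rw [le_div_iff₀ hqR, one_mul]; exact_mod_cast hJ
        push_cast
        rw [mul_div_assoc]
        linarith
    _ = _ := by
        rw [Finset.prod_div_distrib, hq]
        push_cast
        ring

/-- Fewer than `7 ^ k` primes lie below `7 ^ k`. If `m` prime factors are at least `7 ^ k`, then `(7
^ k) ^ m ≤ h ≤ B * J ^ k`, and a `k`-th root gives `7 ^ m ≤ B * J`. -/
theorem pow_card_primeFactors_le {k B J h : ℕ} (hk : 1 ≤ k) (h0 : h ≠ 0)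
    (hh : h ≤ B * J ^ k) : 7 ^ h.primeFactors.card ≤ 7 ^ (7 ^ k) * B * J := by
  set A := h.primeFactors.filter fun p => p < 7 ^ k with hA
  set A' := h.primeFactors.filter fun p => ¬ p < 7 ^ k with hA'
  have hcard : A.card + A'.card = h.primeFactors.card :=
    Finset.card_filter_add_card_filter_not _
  have h1 : A.card ≤ 7 ^ k := by
    have : A ⊆ Finset.range (7 ^ k) := fun p hp => Finset.mem_range.2 (Finset.mem_filter.1 hp).2
    simpa using Finset.card_le_card this
  have h2 : (7 ^ k) ^ A'.card ≤ h := by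
    calc (7 ^ k) ^ A'.card ≤ ∏ p ∈ A', p :=
          Finset.pow_card_le_prod A' _ _ fun p hp => not_lt.1 (Finset.mem_filter.1 hp).2
      _ ≤ ∏ p ∈ h.primeFactors, p :=
          Finset.prod_le_prod_of_subset_of_one_le' (Finset.filter_subset _ _) fun p hp _ =>
            (Nat.prime_of_mem_primeFactors hp).one_le
      _ ≤ h := Nat.le_of_dvd (Nat.pos_of_ne_zero h0) (Nat.prod_primeFactors_dvd h)
  have h3 : 7 ^ A'.card ≤ B * J := by
    refine (Nat.pow_le_pow_iff_left (by omega : k ≠ 0)).1 ?_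
    calc (7 ^ A'.card) ^ k = (7 ^ k) ^ A'.card := by rw [← pow_mul, ← pow_mul, mul_comm]
      _ ≤ B * J ^ k := h2.trans hh
      _ ≤ B ^ k * J ^ k := Nat.mul_le_mul_right _ (Nat.le_self_pow (by omega) B)
      _ = _ := (mul_pow _ _ _).symm
  rw [← hcard, pow_add, mul_assoc]
  exact Nat.mul_le_mul (Nat.pow_le_pow_right (by norm_num) h1) h3

/-- The product is expanded over sets of primes and cut at `∏ p ≤ J`, the range where counting by
full periods is efficient. In the tail each term is at most `6 ^ |T| / J`, and the sum of `6 ^ |T|`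
over all subsets is `7 ^ ω(h)`. -/
theorem prod_one_add_six_div_le {h J : ℕ} {M : ℝ} (hJ : 0 < J)
    (hM : (7 : ℝ) ^ h.primeFactors.card ≤ M * J) :
    ∏ p ∈ h.primeFactors, (1 + 6 / (p : ℝ))
      ≤ M + ∑ T ∈ (((Finset.Icc 1 J).filter Nat.Prime).powerset.filter
          (fun T => ∏ p ∈ T, p ≤ J)),
          if ∀ p ∈ T, p ∣ h then ∏ p ∈ T, (6 / (p : ℝ)) else 0 := by
  have hJR : (0 : ℝ) < J := by exact_mod_cast hJ
  rw [Finset.prod_one_add, ← Finset.sum_filter_not_add_sum_filter _ (fun T => ∏ p ∈ T, p ≤ J)]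
  refine add_le_add ?_ ?_
  · calc ∑ T ∈ h.primeFactors.powerset.filter (fun T => ¬ ∏ p ∈ T, p ≤ J), ∏ p ∈ T, (6 / (p : ℝ))
        ≤ ∑ T ∈ h.primeFactors.powerset.filter (fun T => ¬ ∏ p ∈ T, p ≤ J),
          (∏ p ∈ T, (6 : ℝ)) * (1 / J) := by
          refine Finset.sum_le_sum fun T hT => ?_
          have h1 := not_le.1 (Finset.mem_filter.1 hT).2
          have h2 : (J : ℝ) ≤ ∏ p ∈ T, (p : ℝ) := by
            rw [← Nat.cast_prod]; exact Nat.cast_le.2 h1.le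
          rw [Finset.prod_div_distrib, div_eq_mul_one_div]
          gcongr
      _ ≤ ∑ T ∈ h.primeFactors.powerset, (∏ p ∈ T, (6 : ℝ)) * (1 / J) :=
          Finset.sum_le_sum_of_subset_of_nonneg (Finset.filter_subset _ _)
            fun _ _ _ => by positivity
      _ = (7 : ℝ) ^ h.primeFactors.card * (1 / J) := by
          rw [← Finset.sum_mul, ← Finset.prod_one_add, Finset.prod_const]; norm_num
      _ ≤ M := by
          rw [mul_one_div, div_le_iff₀ hJR]; exact hM
  · rw [← Finset.sum_filter]
    refine Finset.sum_le_sum_of_subset_of_nonneg (fun T hT => ?_) fun _ _ _ => by positivity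
    obtain ⟨h1, h2⟩ := Finset.mem_filter.1 hT
    have h1 := Finset.mem_powerset.1 h1
    refine Finset.mem_filter.2 ⟨Finset.mem_filter.2 ⟨Finset.mem_powerset.2 fun p hp => ?_, h2⟩,
      fun p hp => Nat.dvd_of_mem_primeFactors (h1 hp)⟩
    have hpp := Nat.prime_of_mem_primeFactors (h1 hp)
    refine Finset.mem_filter.2 ⟨Finset.mem_Icc.2 ⟨hpp.one_le, le_trans ?_ h2⟩, hpp⟩
    exact Nat.le_of_dvd (Finset.prod_pos fun q hq => (Nat.prime_of_mem_primeFactors (h1 hq)).pos)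
      (Finset.dvd_prod_of_mem (fun q => q) hp)

theorem prod_one_add_div_sq_le {C : ℝ} (hC : 0 ≤ C) (J : ℕ) :
    ∏ p ∈ (Finset.Icc 1 J).filter Nat.Prime, (1 + C / (p : ℝ) ^ 2) ≤ Real.exp (2 * C) := by
  calc ∏ p ∈ (Finset.Icc 1 J).filter Nat.Prime, (1 + C / (p : ℝ) ^ 2)
      ≤ ∏ p ∈ (Finset.Icc 1 J).filter Nat.Prime, Real.exp (C / (p : ℝ) ^ 2) :=
        Finset.prod_le_prod (fun p _ => by positivity) fun p _ => by
          rw [add_comm]; exact Real.add_one_le_exp _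
    _ = Real.exp (∑ p ∈ (Finset.Icc 1 J).filter Nat.Prime, C / (p : ℝ) ^ 2) :=
        (Real.exp_sum _ _).symm
    _ ≤ _ := by
        rw [Real.exp_le_exp]
        calc ∑ p ∈ (Finset.Icc 1 J).filter Nat.Prime, C / (p : ℝ) ^ 2
            ≤ ∑ p ∈ Finset.Ioo 0 (J + 1), C / (p : ℝ) ^ 2 := by
              refine Finset.sum_le_sum_of_subset_of_nonneg (fun p hp => ?_)
                fun _ _ _ => by positivity
              have := Finset.mem_Icc.1 (Finset.mem_filter.1 hp).1
              exact Finset.mem_Ioo.2 ⟨by omega, by omega⟩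
          _ = C * ∑ p ∈ Finset.Ioo 0 (J + 1), ((p : ℝ) ^ 2)⁻¹ := by
              rw [Finset.mul_sum]; simp only [div_eq_mul_inv]
          _ ≤ C * 2 := by
              refine mul_le_mul_of_nonneg_left ?_ hC
              have := sum_Ioo_inv_sq_le (α := ℝ) 0 (J + 1)
              simpa using this
          _ = _ := mul_comm _ _

/-- The singular series `∏_{p ∣ f(j)} (1 + 6 / p)` is bounded on average over `j < J`. -/
theorem sum_prod_one_add_six_div_le {f : Polynomial ℤ} (hdeg : 1 ≤ f.natDegree)
    (hlead : 0 < f.leadingCoeff) {B J : ℕ}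
    (hf : ∀ j < J, (f.eval (j : ℤ)).natAbs ≤ B * J ^ f.natDegree) :
    ∑ j ∈ (Finset.range J).filter (fun j : ℕ => f.eval (j : ℤ) ≠ 0),
        ∏ p ∈ (f.eval (j : ℤ)).natAbs.primeFactors, (1 + 6 / (p : ℝ))
      ≤ (7 ^ (7 ^ f.natDegree) * B
          + 2 * Real.exp (12 * (f.natDegree + f.leadingCoeff.toNat : ℕ))) * J := by
  classical
  rcases Nat.eq_zero_or_pos J with rfl | hJ
  · simp
  set K := f.natDegree + f.leadingCoeff.toNat with hK
  set M : ℝ := 7 ^ (7 ^ f.natDegree) * B with hM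
  set D := ((Finset.Icc 1 J).filter Nat.Prime).powerset.filter (fun T => ∏ p ∈ T, p ≤ J) with hD
  set A := (Finset.range J).filter (fun j : ℕ => f.eval (j : ℤ) ≠ 0) with hA
  have hAJ : (A.card : ℝ) ≤ J := by
    have := Finset.card_filter_le (Finset.range J) (fun j : ℕ => f.eval (j : ℤ) ≠ 0)
    rw [Finset.card_range] at this
    exact_mod_cast this
  have hDp : ∀ T ∈ D, (∀ p ∈ T, p.Prime) ∧ ∏ p ∈ T, p ≤ J := fun T hT =>
    ⟨fun p hp => (Finset.mem_filter.1
      (Finset.mem_powerset.1 (Finset.mem_filter.1 hT).1 hp)).2, (Finset.mem_filter.1 hT).2⟩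
  calc ∑ j ∈ A, ∏ p ∈ (f.eval (j : ℤ)).natAbs.primeFactors, (1 + 6 / (p : ℝ))
      ≤ ∑ j ∈ A, (M + ∑ T ∈ D, if ∀ p ∈ T, p ∣ (f.eval (j : ℤ)).natAbs then
          ∏ p ∈ T, (6 / (p : ℝ)) else 0) := by
        refine Finset.sum_le_sum fun j hj => ?_
        obtain ⟨h1, h2⟩ := Finset.mem_filter.1 hj
        have h3 := pow_card_primeFactors_le hdeg (Int.natAbs_ne_zero.2 h2)
          (hf j (Finset.mem_range.1 h1))
        exact prod_one_add_six_div_le hJ (by rw [hM]; exact_mod_cast h3)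
    _ = A.card * M + ∑ T ∈ D, ∑ j ∈ A, (if ∀ p ∈ T, p ∣ (f.eval (j : ℤ)).natAbs then
          ∏ p ∈ T, (6 / (p : ℝ)) else 0) := by
        rw [Finset.sum_add_distrib, Finset.sum_comm, Finset.sum_const, nsmul_eq_mul]
    -- The density `K/p` of the `j` with `p ∣ f(j)` meets the coefficient `6/p`, so the remaining
    -- Euler product converges.
    _ ≤ J * M + ∑ T ∈ D, 2 * (J : ℝ) * ∏ p ∈ T, (6 * K / (p : ℝ) ^ 2) := by
        refine add_le_add (mul_le_mul_of_nonneg_right hAJ (by positivity))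
          (Finset.sum_le_sum fun T hT => ?_)
        rw [← Finset.sum_filter, Finset.sum_const, nsmul_eq_mul]
        have h1 := card_range_filter_prod_dvd_eval_le hdeg hlead (hDp T hT).1 (hDp T hT).2
        have h2 : ((A.filter fun j : ℕ => ∀ p ∈ T, p ∣ (f.eval (j : ℤ)).natAbs).card : ℝ)
            ≤ ((Finset.range J).filter fun b : ℕ => ∀ p ∈ T, (p : ℤ) ∣ f.eval (b : ℤ)).card := by
          refine Nat.cast_le.2 (Finset.card_le_card fun j hj => ?_)
          obtain ⟨h3, h4⟩ := Finset.mem_filter.1 hj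
          exact Finset.mem_filter.2 ⟨(Finset.mem_filter.1 h3).1,
            fun p hp => Int.natCast_dvd.2 (h4 p hp)⟩
        calc _ ≤ (2 * J * ∏ p ∈ T, ((K : ℝ) / p)) * ∏ p ∈ T, (6 / (p : ℝ)) :=
              mul_le_mul_of_nonneg_right (h2.trans h1) (by positivity)
          _ = _ := by
            rw [mul_assoc, ← Finset.prod_mul_distrib]
            congr 1
            refine Finset.prod_congr rfl fun p _ => ?_
            rw [div_mul_div_comm]; ring
    _ ≤ J * M + 2 * J * ∏ p ∈ (Finset.Icc 1 J).filter Nat.Prime, (1 + 6 * K / (p : ℝ) ^ 2) := by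
        rw [← Finset.mul_sum, Finset.prod_one_add]
        gcongr
        exact Finset.filter_subset _ _
    _ ≤ J * M + 2 * J * Real.exp (2 * (6 * K)) := by
        gcongr
        exact prod_one_add_div_sq_le (by positivity) J
    _ = _ := by
        have : 2 * (6 * (K : ℝ)) = 12 * K := by ring
        rw [this]; ring

/-! ### The second moment: counting coincidences. -/

/-- Cauchy–Schwarz: a map with few coincidences has many fibres of at least half the mean size. -/
theorem sq_card_le_mul_card_filter_mul_sum {α β : Type*} [DecidableEq β] (A : Finset α)
    (B : Finset β) (φ : α → β) (hφ : ∀ a ∈ A, φ a ∈ B) {t : ℝ} (ht : 0 ≤ t)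
    (htB : 2 * (t * B.card) ≤ A.card) :
    (A.card : ℝ) ^ 2 ≤ 4 * (((B.filter fun b => t ≤ (A.filter fun a => φ a = b).card).card : ℝ)
      * ∑ a ∈ A, ((A.filter fun a' => φ a' = φ a).card : ℝ)) := by
  set r : β → ℝ := fun b => ((A.filter fun a => φ a = b).card : ℝ) with hr
  set E := B.filter fun b => t ≤ r b with hE
  have h1 : (A.card : ℝ) = ∑ b ∈ B, r b := by
    rw [Finset.card_eq_sum_card_fiberwise hφ]; push_cast; rfl
  have h2 : ∑ b ∈ B, r b ≤ ∑ b ∈ E, r b + t * B.card := by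
    rw [← Finset.sum_filter_add_sum_filter_not B (fun b => t ≤ r b)]
    refine add_le_add le_rfl ?_
    calc ∑ b ∈ B.filter (fun b => ¬ t ≤ r b), r b ≤ ∑ b ∈ B.filter (fun b => ¬ t ≤ r b), t :=
          Finset.sum_le_sum fun b hb => (not_le.1 (Finset.mem_filter.1 hb).2).le
      _ = (B.filter (fun b => ¬ t ≤ r b)).card * t := by rw [Finset.sum_const, nsmul_eq_mul]
      _ ≤ B.card * t := by
          gcongr
          exact Finset.filter_subset _ _
      _ = _ := mul_comm _ _
  -- Fibres smaller than `t` hold at most half of `A` by `htB`.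
  have h3 : (A.card : ℝ) ≤ 2 * ∑ b ∈ E, r b := by linarith
  have h4 : (∑ b ∈ E, r b) ^ 2 ≤ E.card * ∑ b ∈ E, r b ^ 2 := sq_sum_le_card_mul_sum_sq
  have h5 : ∑ b ∈ E, r b ^ 2 ≤ ∑ a ∈ A, r (φ a) := by
    rw [← Finset.sum_fiberwise_of_maps_to hφ (fun a => r (φ a))]
    refine (Finset.sum_le_sum_of_subset_of_nonneg (Finset.filter_subset _ _)
      fun _ _ _ => sq_nonneg _).trans (Finset.sum_le_sum fun b _ => le_of_eq ?_)
    rw [Finset.sum_congr rfl fun a ha => by rw [(Finset.mem_filter.1 ha).2], Finset.sum_const,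
      nsmul_eq_mul, sq]
  calc (A.card : ℝ) ^ 2 ≤ (2 * ∑ b ∈ E, r b) ^ 2 := by gcongr
    _ = 4 * (∑ b ∈ E, r b) ^ 2 := by ring
    _ ≤ 4 * (E.card * ∑ a ∈ A, r (φ a)) := by
      gcongr
      exact h4.trans (by gcongr)

open Polynomial in
theorem exists_natAbs_eval_le (R : ℤ[X]) :
    ∃ B : ℕ, 1 ≤ B ∧ ∀ J j : ℕ, j < J → (R.eval (j : ℤ)).natAbs ≤ B * J ^ R.natDegree := by
  refine ⟨1 + ∑ i ∈ Finset.range (R.natDegree + 1), (R.coeff i).natAbs, by omega,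
    fun J j hj => ?_⟩
  rw [eval_eq_sum_range]
  calc (∑ i ∈ Finset.range (R.natDegree + 1), R.coeff i * (j : ℤ) ^ i).natAbs
      ≤ ∑ i ∈ Finset.range (R.natDegree + 1), (R.coeff i * (j : ℤ) ^ i).natAbs :=
        Int.natAbs_sum_le _ _
    _ ≤ ∑ i ∈ Finset.range (R.natDegree + 1), (R.coeff i).natAbs * J ^ R.natDegree := by
        refine Finset.sum_le_sum fun i hi => ?_
        rw [Int.natAbs_mul, Int.natAbs_pow, Int.natAbs_natCast]
        refine Nat.mul_le_mul_left _ ((Nat.pow_le_pow_left hj.le i).trans ?_)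
        exact Nat.pow_le_pow_right (by omega) (by have := Finset.mem_range.1 hi; omega)
    _ ≤ _ := by
        rw [← Finset.sum_mul]
        exact Nat.mul_le_mul_right _ (by omega)

open Polynomial in
theorem exists_forall_le_eval {R : ℤ[X]} (hdeg : 1 ≤ R.natDegree) (hlead : 0 < R.leadingCoeff)
    (c : ℤ) : ∃ j₀ : ℕ, ∀ j : ℕ, j₀ ≤ j → c ≤ R.eval (j : ℤ) := by
  have hinj : Function.Injective (Int.castRingHom ℝ) := (Int.castRingHom ℝ).injective_int
  have h1 : Filter.Tendsto (fun x : ℝ => (R.map (Int.castRingHom ℝ)).eval x)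
      Filter.atTop Filter.atTop := by
    apply tendsto_atTop_of_leadingCoeff_nonneg
    · rw [degree_map_eq_of_injective hinj]
      exact natDegree_pos_iff_degree_pos.1 hdeg
    · rw [leadingCoeff_map_of_injective hinj]
      simpa using hlead.le
  obtain ⟨j₀, hj⟩ := Filter.eventually_atTop.1
    ((h1.comp tendsto_natCast_atTop_atTop).eventually_ge_atTop (c : ℝ))
  refine ⟨j₀, fun j hjj => ?_⟩
  have h2 := hj j hjj
  have h3 : (R.map (Int.castRingHom ℝ)).eval ((Int.castRingHom ℝ) (j : ℤ))
      = (Int.castRingHom ℝ) (R.eval (j : ℤ)) := eval_map_apply _ _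
  simp only [eq_intCast, Int.cast_natCast] at h3
  rw [Function.comp_apply, h3] at h2
  exact_mod_cast h2

open Polynomial in
theorem card_filter_eval_eq_le {R : ℤ[X]} (hdeg : 1 ≤ R.natDegree) (c : ℤ) (I : Finset ℕ) :
    (I.filter fun j : ℕ => R.eval (j : ℤ) = c).card ≤ R.natDegree := by
  have h0 : R - C c ≠ 0 := by
    intro h
    rw [sub_eq_zero.1 h, natDegree_C] at hdeg
    omega
  have h1 : (I.filter fun j : ℕ => R.eval (j : ℤ) = c).card ≤ (R - C c).roots.toFinset.card := by
    refine Finset.card_le_card_of_injOn (fun j : ℕ => (j : ℤ)) ?_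
      Nat.cast_injective.injOn
    intro j hj
    have := (Finset.mem_filter.1 hj).2
    rw [Finset.mem_coe, Multiset.mem_toFinset, mem_roots h0, IsRoot.def, eval_sub, eval_C, this,
      sub_self]
  have h2 := Multiset.toFinset_card_le (R - C c).roots
  have h3 := card_roots' (R - C c)
  rw [natDegree_sub_C] at h3
  omega

open Polynomial in
/-- For fixed `c`, the number of prime pairs with difference `c - R(j)`, summed over `j`. -/
theorem sum_card_prime_and_prime_add_sub_eval_le {R : ℤ[X]} (hdeg : 1 ≤ R.natDegree)
    (hlead : 0 < R.leadingCoeff) {B J N : ℕ} (hN : 2 ≤ N) {c : ℤ}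
    (hc : c.natAbs ≤ B * J ^ R.natDegree)
    (hB : ∀ j < J, (R.eval (j : ℤ)).natAbs ≤ B * J ^ R.natDegree)
    {I : Finset ℕ} (hI : I ⊆ Finset.range J) :
    ∑ j ∈ I, (((Finset.range N).filter fun n : ℕ =>
        n.Prime ∧ ((n : ℤ) + (c - R.eval (j : ℤ))).toNat.Prime).card : ℝ)
      ≤ R.natDegree * N + 624 * (N / Real.log N ^ 2) *
        ((7 ^ (7 ^ R.natDegree) * (4 * B : ℕ)
          + 2 * Real.exp (12 * (R.natDegree + (2 * R.leadingCoeff).toNat : ℕ))) * J) := by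
  -- Its values are, up to sign, the `2 * h` of the prime pair bound. Its degree and leading
  -- coefficient do not depend on `c`, so neither does the final bound.
  set f : ℤ[X] := C 2 * (R - C c) with hf
  have hfdeg : f.natDegree = R.natDegree := by
    rw [hf, natDegree_C_mul two_ne_zero, natDegree_sub_C]
  have hflead : f.leadingCoeff = 2 * R.leadingCoeff := by
    rw [hf, leadingCoeff_mul, leadingCoeff_C, leadingCoeff_sub_of_degree_lt]
    exact degree_C_le.trans_lt (natDegree_pos_iff_degree_pos.1 hdeg)
  have hfeval : ∀ j : ℕ, f.eval (j : ℤ) = 2 * (R.eval (j : ℤ) - c) := fun j => by simp [hf]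
  have havg := sum_prod_one_add_six_div_le (f := f) (B := 4 * B) (J := J) (hfdeg ▸ hdeg)
    (by rw [hflead]; omega) (fun j hj => by
      have := hB j hj
      rw [hfeval, hfdeg, mul_assoc]
      omega)
  rw [hfdeg, hflead] at havg
  rw [← Finset.sum_filter_add_sum_filter_not I fun j : ℕ => R.eval (j : ℤ) = c]
  refine add_le_add ?_ ?_
  · calc _ ≤ ∑ j ∈ I.filter (fun j : ℕ => R.eval (j : ℤ) = c), (N : ℝ) := by
          refine Finset.sum_le_sum fun j _ => ?_
          have := Finset.card_filter_le (Finset.range N) fun n : ℕ =>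
            n.Prime ∧ ((n : ℤ) + (c - R.eval (j : ℤ))).toNat.Prime
          rw [Finset.card_range] at this
          exact_mod_cast this
      _ = (I.filter fun j : ℕ => R.eval (j : ℤ) = c).card * (N : ℝ) := by
          rw [Finset.sum_const, nsmul_eq_mul]
      _ ≤ _ := by
          gcongr
          exact card_filter_eval_eq_le hdeg c I
  · calc _ ≤ ∑ j ∈ I.filter (fun j : ℕ => ¬ R.eval (j : ℤ) = c), 624 * (N / Real.log N ^ 2) *
            ∏ p ∈ (f.eval (j : ℤ)).natAbs.primeFactors, (1 + 6 / (p : ℝ)) := by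
          refine Finset.sum_le_sum fun j hj => ?_
          have hne := (Finset.mem_filter.1 hj).2
          have h1 := card_prime_and_prime_add_le (h := c - R.eval (j : ℤ))
            (sub_ne_zero.2 (Ne.symm hne)) hN
          have h2 : (2 * (c - R.eval (j : ℤ))).natAbs = (f.eval (j : ℤ)).natAbs := by
            rw [hfeval]; omega
          rwa [h2] at h1
      _ = 624 * (N / Real.log N ^ 2) * ∑ j ∈ I.filter (fun j : ℕ => ¬ R.eval (j : ℤ) = c),
            ∏ p ∈ (f.eval (j : ℤ)).natAbs.primeFactors, (1 + 6 / (p : ℝ)) := by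
          rw [Finset.mul_sum]
      _ ≤ 624 * (N / Real.log N ^ 2) * ∑ j ∈ (Finset.range J).filter
            (fun j : ℕ => f.eval (j : ℤ) ≠ 0),
            ∏ p ∈ (f.eval (j : ℤ)).natAbs.primeFactors, (1 + 6 / (p : ℝ)) := by
          refine mul_le_mul_of_nonneg_left
            (Finset.sum_le_sum_of_subset_of_nonneg (fun j hj => ?_)
              fun _ _ _ => Finset.prod_nonneg fun _ _ => by positivity) (by positivity)
          obtain ⟨h1, h2⟩ := Finset.mem_filter.1 hj
          refine Finset.mem_filter.2 ⟨hI h1, ?_⟩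
          rw [hfeval]
          omega
      _ ≤ _ := mul_le_mul_of_nonneg_left havg (by positivity)

open Polynomial in
theorem sum_card_filter_add_eval_eq_le {R : ℤ[X]} (hdeg : 1 ≤ R.natDegree)
    (hlead : 0 < R.leadingCoeff) {B J N : ℕ} (hN : 2 ≤ N)
    (hB : ∀ j < J, (R.eval (j : ℤ)).natAbs ≤ B * J ^ R.natDegree)
    {I : Finset ℕ} (hI : I ⊆ Finset.range J) (hnn : ∀ j ∈ I, 0 ≤ R.eval (j : ℤ)) :
    ∑ q ∈ (Finset.range N).filter Nat.Prime ×ˢ I,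
      ((((Finset.range N).filter Nat.Prime ×ˢ I).filter fun q' : ℕ × ℕ =>
        ((q'.1 : ℤ) + R.eval (q'.2 : ℤ)).toNat = ((q.1 : ℤ) + R.eval (q.2 : ℤ)).toNat).card : ℝ)
      ≤ J * (R.natDegree * N + 624 * (N / Real.log N ^ 2) *
        ((7 ^ (7 ^ R.natDegree) * (4 * B : ℕ)
          + 2 * Real.exp (12 * (R.natDegree + (2 * R.leadingCoeff).toNat : ℕ))) * J)) := by
  set P := (Finset.range N).filter Nat.Prime with hP
  set X := R.natDegree * N + 624 * (N / Real.log N ^ 2) *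
        ((7 ^ (7 ^ R.natDegree) * (4 * B : ℕ)
          + 2 * Real.exp (12 * (R.natDegree + (2 * R.leadingCoeff).toNat : ℕ))) * J) with hX
  have hX0 : 0 ≤ X := by positivity
  have hIJ : (I.card : ℝ) ≤ J := by
    have := Finset.card_le_card hI
    rw [Finset.card_range] at this
    exact_mod_cast this
  calc _ ≤ ∑ q ∈ P ×ˢ I, ∑ j' ∈ I,
        (if ((q.1 : ℤ) + (R.eval (q.2 : ℤ) - R.eval (j' : ℤ))).toNat.Prime then (1 : ℝ) else 0) := by
        refine Finset.sum_le_sum fun q hq => ?_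
        rw [Finset.sum_boole]
        -- Once `(p, j)` and `j'` are fixed, `p'` is determined as `p + R(j) - R(j')`, and it has to
        -- be prime.
        refine Nat.cast_le.2 (Finset.card_le_card_of_injOn Prod.snd ?_ ?_)
        · intro q' hq'
          obtain ⟨h1, h2⟩ := Finset.mem_filter.1 hq'
          obtain ⟨h3, h4⟩ := Finset.mem_product.1 h1
          have h5 := hnn _ h4
          have h6 := hnn _ (Finset.mem_product.1 hq).2
          have h7 : ((q.1 : ℤ) + (R.eval (q.2 : ℤ) - R.eval (q'.2 : ℤ))).toNat = q'.1 := by omega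
          refine Finset.mem_coe.2 (Finset.mem_filter.2 ⟨h4, ?_⟩)
          rw [h7]
          exact (Finset.mem_filter.1 h3).2
        · intro a ha b hb hab
          obtain ⟨h1, h2⟩ := Finset.mem_filter.1 ha
          obtain ⟨h3, h4⟩ := Finset.mem_filter.1 hb
          have h5 := hnn _ (Finset.mem_product.1 h1).2
          have h6 := hnn _ (Finset.mem_product.1 h3).2
          refine Prod.ext ?_ hab
          rw [hab] at h2 h5
          omega
    _ = ∑ j ∈ I, ∑ j' ∈ I, (((Finset.range N).filter fun n : ℕ =>
        n.Prime ∧ ((n : ℤ) + (R.eval (j : ℤ) - R.eval (j' : ℤ))).toNat.Prime).card : ℝ) := by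
        rw [Finset.sum_product_right]
        refine Finset.sum_congr rfl fun j _ => ?_
        rw [Finset.sum_comm]
        refine Finset.sum_congr rfl fun j' _ => ?_
        rw [Finset.sum_boole, hP, Finset.filter_filter]
    _ ≤ ∑ j ∈ I, X := Finset.sum_le_sum fun j hj =>
        sum_card_prime_and_prime_add_sub_eval_le hdeg hlead hN
          (hB j (Finset.mem_range.1 (hI hj))) hB hI
    _ = I.card * X := by rw [Finset.sum_const, nsmul_eq_mul]
    _ ≤ J * X := by gcongr

/-! ### Finiteness, asymptotic inputs and the conclusion. -/

/-- `Set.ncard` is 0 on infinite sets, so a lower bound for the representation count needs this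
finiteness. -/
theorem finite_setOf_prime_add_eval_eq {R : Polynomial ℤ} (hdeg : 1 ≤ R.natDegree)
    (hlead : 0 < R.leadingCoeff) (n : ℕ) :
    {q : ℕ × ℕ | q.1.Prime ∧ 1 ≤ q.2 ∧ (q.1 : ℤ) + R.eval (q.2 : ℤ) = (n : ℤ)}.Finite := by
  obtain ⟨j₀, hj₀⟩ := exists_forall_le_eval hdeg hlead (n + 1)
  refine Set.Finite.of_finite_image (f := Prod.snd) ((Set.finite_Iio j₀).subset ?_) ?_
  · rintro _ ⟨q, ⟨-, -, h⟩, rfl⟩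
    by_contra hcon
    have := hj₀ q.2 (not_lt.1 hcon)
    omega
  · rintro a ⟨-, -, ha⟩ b ⟨-, -, hb⟩ hab
    refine Prod.ext ?_ hab
    rw [hab] at ha
    omega

theorem eventually_le_card_prime :
    ∀ᶠ x : ℝ in Filter.atTop,
      x / (8 * Real.log x) ≤ (((Finset.range (⌊x / 2⌋₊ + 1)).filter Nat.Prime).card : ℝ) := by
  have hlo := Real.isLittleO_log_id_atTop.bound (by norm_num : (0 : ℝ) < 1 / 100)
  filter_upwards [hlo, Filter.eventually_ge_atTop 100] with x hx hx100
  have hlx : 0 < Real.log x := Real.log_pos (by linarith)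
  rw [Real.norm_of_nonneg hlx.le, id, Real.norm_of_nonneg (by linarith)] at hx
  have hx2 : 0 < Real.log (x / 2) := Real.log_pos (by linarith)
  have h1 := Chebyshev.pi_ge' (x := x / 2) (by linarith)
  have h2 : (Nat.primeCounting ⌊x / 2⌋₊ : ℝ)
      = (((Finset.range (⌊x / 2⌋₊ + 1)).filter Nat.Prime).card : ℝ) := by
    rw [Nat.primeCounting, Nat.primeCounting', Nat.count_eq_card_filter_range]
  rw [← h2]
  refine le_trans ?_ h1
  have h3 : Real.log (x / 2 + 2) ≤ Real.log x := Real.log_le_log (by linarith) (by linarith)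
  have h4 : Real.log (x / 2) ≤ Real.log x := Real.log_le_log (by linarith) (by linarith)
  have h5 := Real.log_two_gt_d9
  have h6 : x / 8 ≤ (x / 2 - 1) * Real.log 2 - Real.log (x / 2 + 2) := by
    have : (x / 2 - 1) * (1 / 2) ≤ (x / 2 - 1) * Real.log 2 :=
      mul_le_mul_of_nonneg_left (by linarith) (by linarith)
    linarith
  rw [← div_div]
  exact div_le_div₀ (by linarith) h6 hx2 h4

theorem eventually_log_sq_le_rpow {s : ℝ} (hs : 0 < s) :
    ∀ᶠ x : ℝ in Filter.atTop, Real.log x ^ 2 ≤ x ^ s := by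
  have h := (isLittleO_log_rpow_atTop (half_pos hs)).bound one_pos
  filter_upwards [h, Filter.eventually_ge_atTop 1] with x hx hx1
  have h0 := Real.log_nonneg hx1
  rw [Real.norm_of_nonneg h0, Real.norm_of_nonneg (by positivity), one_mul] at hx
  calc Real.log x ^ 2 ≤ (x ^ (s / 2)) ^ 2 := by gcongr
    _ = x ^ s := by
      rw [← Real.rpow_natCast, ← Real.rpow_mul (by linarith)]
      norm_num

theorem theorem7 (k : ℕ) (hk : 2 ≤ k) (R : Polynomial ℤ) (hdeg : R.natDegree = k)
    (hlead : 0 < R.leadingCoeff) :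
    ∃ c₁ c₂ x₀ : ℝ, 0 < c₁ ∧ 0 < c₂ ∧ 0 < x₀ ∧
      ∀ x : ℝ, x₀ ≤ x →
        c₂ * x ≤
          (Set.ncard {n : ℕ | 1 ≤ n ∧ (n : ℝ) ≤ x ∧
            c₁ * (x ^ (1 / (k : ℝ)) / Real.log x) ≤ (primePolyReprCount R n : ℝ)} : ℝ) := by
  classical
  have hdeg1 : 1 ≤ R.natDegree := by omega
  have hk0 : (0 : ℝ) < k := by exact_mod_cast (by omega : 0 < k)
  obtain ⟨B, hB1, hB⟩ := exists_natAbs_eval_le R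
  obtain ⟨J₀, hJ₀⟩ := exists_forall_le_eval hdeg1 hlead 0
  -- Chosen so that `J ≤ X / b` gives `B * J ^ k ≤ x / 2`, leaving the other half of `x` for the
  -- prime.
  set b : ℝ := (2 * B : ℝ) ^ (1 / (k : ℝ)) with hb
  have hB1' : (1 : ℝ) ≤ B := by exact_mod_cast hB1
  have hb1 : 1 ≤ b := Real.one_le_rpow (by linarith) (by positivity)
  obtain ⟨C, hC⟩ : ∃ C : ℝ, C = 624 * (7 ^ (7 ^ R.natDegree) * (4 * B : ℕ)
          + 2 * Real.exp (12 * (R.natDegree + (2 * R.leadingCoeff).toNat : ℕ))) := ⟨_, rfl⟩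
  have hC0 : 0 < C := by rw [hC]; positivity
  have hX : Filter.Tendsto (fun x : ℝ => x ^ (1 / (k : ℝ))) Filter.atTop Filter.atTop :=
    tendsto_rpow_atTop (by positivity)
  have hev := (eventually_le_card_prime.and ((eventually_log_sq_le_rpow
    (by positivity : (0 : ℝ) < 1 / (k : ℝ))).and ((hX.eventually_ge_atTop
    (b * (4 * (J₀ + 2)))).and (Filter.eventually_ge_atTop 16))))
  obtain ⟨x₀, hx₀⟩ := Filter.eventually_atTop.1 hev
  -- There are at least `xX / (32 b log x)` pairs, and `c₁` takes half the resulting mean. In `c₂`,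
  -- `4096 = 4 * 32²`: the 4 comes from Cauchy–Schwarz, the square from squaring the number of
  -- pairs.
  refine ⟨1 / (64 * b), 1 / (4096 * b ^ 2 * (k + 4 * C)), max x₀ 1, by positivity, by positivity,
    by positivity, fun x hx => ?_⟩
  obtain ⟨hprime, hlogsq, hXlarge, hx16⟩ := hx₀ x ((le_max_left _ _).trans hx)
  set X := x ^ (1 / (k : ℝ)) with hXdef
  have hx0 : 0 < x := by linarith
  have hlog : 0 < Real.log x := Real.log_pos (by linarith)
  have hX0 : 0 < X := by positivity
  set J := ⌊X / b⌋₊ with hJ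
  set N := ⌊x / 2⌋₊ + 1 with hN
  have hJle : (J : ℝ) ≤ X / b := Nat.floor_le (by positivity)
  have hJX : (J : ℝ) ≤ X := hJle.trans (div_le_self hX0.le hb1)
  have hXb : 4 * ((J₀ : ℝ) + 2) ≤ X / b := by
    rw [le_div_iff₀ (by positivity)]; linarith
  have hJgt : X / b - 1 < J := Nat.sub_one_lt_floor _
  have hJ₀nn : (0 : ℝ) ≤ J₀ := Nat.cast_nonneg _
  have hBJ : (B : ℝ) * (J : ℝ) ^ k ≤ x / 2 := by
    have h1 : (J : ℝ) ^ k ≤ x / (2 * B) := by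
      calc (J : ℝ) ^ k ≤ (X / b) ^ k := by gcongr
        _ = x / (2 * B) := by
          rw [div_pow, hXdef, hb, ← Real.rpow_natCast, ← Real.rpow_natCast, ← Real.rpow_mul hx0.le,
            ← Real.rpow_mul (by linarith), one_div, inv_mul_cancel₀ hk0.ne', Real.rpow_one,
            Real.rpow_one]
    calc (B : ℝ) * (J : ℝ) ^ k ≤ B * (x / (2 * B)) := by gcongr
      _ = x / 2 := by field_simp
  have hNle : (N : ℝ) ≤ x := by
    have := Nat.floor_le (by linarith : 0 ≤ x / 2)
    rw [hN]; push_cast; linarith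
  have hNge : x / 2 ≤ N := by
    have := (Nat.lt_floor_add_one (x / 2)).le
    rw [hN]; push_cast; exact this
  have hN2 : 2 ≤ N := by
    have : (2 : ℝ) ≤ N := by linarith
    exact_mod_cast this
  have hlogN : Real.log x / 2 ≤ Real.log N := by
    have h1 : √x ≤ N := by
      refine le_trans ?_ hNge
      rw [Real.sqrt_le_left (by linarith)]
      nlinarith
    rw [← Real.log_sqrt hx0.le]
    exact Real.log_le_log (Real.sqrt_pos.2 hx0) h1
  set I := (Finset.range J).filter (fun j => J₀ + 1 ≤ j) with hI
  have hIsub : I ⊆ Finset.range J := Finset.filter_subset _ _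
  have hIcard : X / (4 * b) ≤ I.card := by
    have h1 : Finset.Ico (J₀ + 1) J ⊆ I := fun j hj => by
      have := Finset.mem_Ico.1 hj
      exact Finset.mem_filter.2 ⟨Finset.mem_range.2 this.2, this.1⟩
    have h2 := Finset.card_le_card h1
    rw [Nat.card_Ico] at h2
    have h3 : (J : ℝ) ≤ I.card + (J₀ + 1) := by
      have : J ≤ I.card + (J₀ + 1) := by omega
      exact_mod_cast this
    have h4 : X / (4 * b) = (X / b) / 4 := by field_simp
    linarith
  set P := (Finset.range N).filter Nat.Prime with hP
  set φ : ℕ × ℕ → ℕ := fun q => ((q.1 : ℤ) + R.eval (q.2 : ℤ)).toNat with hφ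
  have hnn : ∀ j ∈ I, 0 ≤ R.eval (j : ℤ) := fun j hj =>
    hJ₀ j (by have := (Finset.mem_filter.1 hj).2; omega)
  have hmaps : ∀ q ∈ P ×ˢ I, φ q ∈ Finset.Icc 1 ⌊x⌋₊ := by
    intro q hq
    obtain ⟨hq1, hq2⟩ := Finset.mem_product.1 hq
    obtain ⟨hq3, hq4⟩ := Finset.mem_filter.1 hq1
    have h0 := hnn _ hq2
    have hpos := hq4.pos
    refine Finset.mem_Icc.2 ⟨by simp only [hφ]; omega, Nat.le_floor ?_⟩
    have h1 : φ q ≤ ⌊x / 2⌋₊ + B * J ^ k := by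
      have h2 := hB J q.2 (Finset.mem_range.1 (hIsub hq2))
      rw [hdeg] at h2
      have h3 := Finset.mem_range.1 hq3
      simp only [hφ]
      omega
    calc (φ q : ℝ) ≤ ((⌊x / 2⌋₊ + B * J ^ k : ℕ) : ℝ) := Nat.cast_le.2 h1
      _ = ⌊x / 2⌋₊ + B * (J : ℝ) ^ k := by push_cast; rfl
      _ ≤ x / 2 + x / 2 := add_le_add (Nat.floor_le (by linarith)) hBJ
      _ = x := by ring
  have hcardA : x * X / (32 * b * Real.log x) ≤ ((P ×ˢ I).card : ℝ) := by
    rw [Finset.card_product, Nat.cast_mul]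
    calc x * X / (32 * b * Real.log x) = x / (8 * Real.log x) * (X / (4 * b)) := by
          field_simp; norm_num
      _ ≤ _ := by gcongr
  set t := 1 / (64 * b) * (X / Real.log x) with ht
  have ht0 : 0 ≤ t := by positivity
  have htB : 2 * (t * (Finset.Icc 1 ⌊x⌋₊).card) ≤ (P ×ˢ I).card := by
    refine le_trans ?_ hcardA
    have h1 : ((Finset.Icc 1 ⌊x⌋₊).card : ℝ) ≤ x := by
      rw [Nat.card_Icc, Nat.add_sub_cancel]; exact Nat.floor_le hx0.le
    calc 2 * (t * (Finset.Icc 1 ⌊x⌋₊).card) ≤ 2 * (t * x) := by gcongr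
      _ = _ := by rw [ht]; field_simp; norm_num
  have hCS := sq_card_le_mul_card_filter_mul_sum (P ×ˢ I) (Finset.Icc 1 ⌊x⌋₊) φ hmaps ht0 htB
  have hsec := sum_card_filter_add_eval_eq_le hdeg1 hlead hN2 (fun j hj => hB J j hj) hIsub hnn
  have hsec' : ∑ q ∈ P ×ˢ I, (((P ×ˢ I).filter fun q' => φ q' = φ q).card : ℝ)
      ≤ (k + 4 * C) * (x * X ^ 2 / Real.log x ^ 2) := by
    refine hsec.trans ?_
    have h1 : (N : ℝ) / Real.log N ^ 2 ≤ 4 * (x / Real.log x ^ 2) := by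
      calc (N : ℝ) / Real.log N ^ 2 ≤ x / (Real.log x / 2) ^ 2 := by gcongr
        _ = _ := by field_simp; norm_num
    -- This is where `log² x ≤ X` absorbs the coincidences with `R(j) = R(j')`.
    have h2 : x ≤ x * X / Real.log x ^ 2 := by
      rw [le_div_iff₀ (by positivity)]
      gcongr
    have h3 : (R.natDegree : ℝ) * N ≤ k * (x * X / Real.log x ^ 2) := by
      rw [hdeg]
      gcongr
      exact hNle.trans h2
    have h4 : C * (N / Real.log N ^ 2 * J) ≤ C * (4 * (x / Real.log x ^ 2) * X) := by gcongr
    calc _ = J * (R.natDegree * N + C * (N / Real.log N ^ 2 * J)) := by rw [hC]; ring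
      _ ≤ X * (k * (x * X / Real.log x ^ 2) + C * (4 * (x / Real.log x ^ 2) * X)) := by gcongr
      _ = _ := by ring
  set E := (Finset.Icc 1 ⌊x⌋₊).filter fun n => t ≤ ((P ×ˢ I).filter fun q => φ q = n).card with hE
  have hEsub : (E : Set ℕ) ⊆ {n : ℕ | 1 ≤ n ∧ (n : ℝ) ≤ x ∧ t ≤ (primePolyReprCount R n : ℝ)} := by
    intro n hn
    obtain ⟨h1, h2⟩ := Finset.mem_filter.1 (Finset.mem_coe.1 hn)
    obtain ⟨h3, h4⟩ := Finset.mem_Icc.1 h1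
    refine ⟨h3, (Nat.cast_le.2 h4).trans (Nat.floor_le hx0.le), h2.trans (Nat.cast_le.2 ?_)⟩
    rw [primePolyReprCount, ← Set.ncard_coe_finset]
    refine Set.ncard_le_ncard ?_ (finite_setOf_prime_add_eval_eq hdeg1 hlead n)
    intro q hq
    obtain ⟨h5, h6⟩ := Finset.mem_filter.1 (Finset.mem_coe.1 hq)
    obtain ⟨h7, h8⟩ := Finset.mem_product.1 h5
    have h9 := hnn _ h8
    refine ⟨(Finset.mem_filter.1 h7).2, ?_, ?_⟩
    · have := (Finset.mem_filter.1 h8).2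
      omega
    · simp only [hφ] at h6
      omega
  have hfin : {n : ℕ | 1 ≤ n ∧ (n : ℝ) ≤ x ∧ t ≤ (primePolyReprCount R n : ℝ)}.Finite :=
    (Set.finite_Iic ⌊x⌋₊).subset fun n hn => Nat.le_floor hn.2.1
  have hEcard := Set.ncard_le_ncard hEsub hfin
  rw [Set.ncard_coe_finset] at hEcard
  refine le_trans ?_ (Nat.cast_le.2 hEcard)
  have hfinal : (x * X / (32 * b * Real.log x)) ^ 2
      ≤ 4 * ((E.card : ℝ) * ((k + 4 * C) * (x * X ^ 2 / Real.log x ^ 2))) := by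
    calc (x * X / (32 * b * Real.log x)) ^ 2 ≤ ((P ×ˢ I).card : ℝ) ^ 2 := by gcongr
      _ ≤ _ := hCS
      _ ≤ _ := by gcongr
  have hY : 0 < x * X ^ 2 / Real.log x ^ 2 := by positivity
  have hbC : 0 < 4096 * b ^ 2 * (k + 4 * C) := by positivity
  rw [div_mul_eq_mul_div, one_mul, div_le_iff₀ hbC]
  have e1 : (x * X / (32 * b * Real.log x)) ^ 2
      = x / (1024 * b ^ 2) * (x * X ^ 2 / Real.log x ^ 2) := by
    field_simp; norm_num
  rw [e1] at hfinal
  have h1 : x / (1024 * b ^ 2) ≤ 4 * (E.card * (k + 4 * C)) := by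
    refine le_of_mul_le_mul_right (hfinal.trans_eq ?_) hY
    ring
  rw [div_le_iff₀ (by positivity)] at h1
  linarith
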